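/- **Setting.** There are $n\ge 1$ resources with capacities $c_i>0$ and $m$ requests, which arrive one at a time. A request $j$ offers a finite set $\mathcal K$ of options; option $k$ consumes $a_{ijk}\ge 0$ of resource $i$ and yields $w_{ijk}\ge 0$ of profit type $i$, $1\le i\le n$. On arrival each request must be served irrevocably by one option or by the null option $\bot$, for which $a_{ij\bot}=w_{ij\bot}=0$. The total consumption of each resource $i$ must not exceed $c_i$; the objective is the minimum over $i$ of the total type-$i$ profit. The requests are drawn independently from one unknown discrete (finitely or countably supported) distribution, in which request $j$ has probability $p_j$. The benchmark $W_E$ is the optimal value of the linear program of the expected instance: maximize $\lambda$ subject to $$\sum_{j,k} m p_j w_{ijk}x_{jk}\ge\lambda,\qquad \sum_{j,k} m p_j a_{ijk}x_{jk}\le c_i\quad\text{for all } i,\qquad \sum_k x_{jk}\le 1,\quad x_{jk}\ge 0\quad\text{for all } j,k .$$ Assume $W_E>0$. Let $\gamma$ and $w_{\max}$ be numbers with $a_{ijk}\le\gamma c_i$ and $w_{ijk}\le w_{\max}\le\gamma W_E$ for all $i,j,k$; for instance $w_{\max}=\max_{i,j,k} w_{ijk}$ and $\gamma=\max\big(\{a_{ijk}/c_i\}_{i,j,k}\cup\{w_{ijk}/W_E\}_{i,j,k}\big)$.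 Let $\epsilon\in[1/m,1/2]$ be such that $\epsilon 2^l=1$ for an integer $l$ and $\epsilon m$ is an integer. **Algorithm.** The input is $c_1,\dots,c_n$, $m$, $\gamma$, $w_{\max}$, $\epsilon$; beyond it, each decision uses only the requests seen so far. Put $l=\log_2(1/\epsilon)$, $\delta=\epsilon/(3l)$, $t_{-1}=\epsilon m$ and $t_r=\epsilon m2^r$ for $0\le r\le l-1$. Stage $-1$ consists of the first $\epsilon m$ requests, all of which get $\bot$; stage $r\ge 0$ consists of the $t_r$ requests with numbers $t_r+1,\dots,2t_r$. Put $\epsilon_{x,r}=\sqrt{4\gamma m\ln(2n/\delta)/t_r}$ for $r\ge -1$. At the start of stage $r\ge 0$ compute the fractional optimum $e_{r-1}$ of the offline instance that consists of the $t_{r-1}$ requests of stage $r-1$ with capacities $t_{r-1}c_i/m$, and set $$Z_r=\frac{e_{r-1}}{1+\epsilon_{x,r-1}}\cdot\frac{m}{t_{r-1}},\qquad \epsilon_{y,r}=\sqrt{\frac{2w_{\max}m\ln(2n/\delta)}{t_rZ_r}},$$ $$\phi_{x,i}=\frac{\epsilon_{x,r}}{\gamma c_i}\cdot\frac{\big(1+\frac{\epsilon_{x,r}}{m\gamma}\big)^{t_r-1}}{(1+\epsilon_{x,r})^{(1+\epsilon_{x,r})\frac{t_r}{m\gamma}}},\qquad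 \phi_{y,i}=\frac{\epsilon_{y,r}}{w_{\max}}\cdot\frac{\big(1-\frac{\epsilon_{y,r}Z_r}{m w_{\max}}\big)^{t_r-1}}{(1-\epsilon_{y,r})^{(1-\epsilon_{y,r})\frac{t_rZ_r}{m w_{\max}}}} .$$ Serve each request $j$ of stage $r$ by an option $k^*\in\mathcal K\cup\{\bot\}$ that minimizes $\sum_i a_{ijk}\phi_{x,i}-\sum_i w_{ijk}\phi_{y,i}$ (ties are broken by any fixed rule applied to this function of $k$), and then multiply $$\phi_{x,i}\ \text{ by }\ \frac{(1+\epsilon_{x,r})^{a_{ijk^*}/(\gamma c_i)}}{1+\frac{\epsilon_{x,r}}{m\gamma}},\qquad \phi_{y,i}\ \text{ by }\ \frac{(1-\epsilon_{y,r})^{w_{ijk^*}/w_{\max}}}{1-\frac{\epsilon_{y,r}Z_r}{m w_{\max}}} .$$ **Theorem.** There are absolute constants $c_0,C>0$ such that, in this setting, if $\gamma\le c_0\,\epsilon^2/\ln(n/\epsilon)$, then with probability at least $1-\epsilon$ the algorithm exceeds no capacity and obtains a total profit of at least $W_E(1-C\epsilon)$ of every type. -/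

import Mathlib

/-! Online resource allocation with i.i.d. requests, its expected-instance linear program, and the
staged multiplicative-weight algorithm for an unknown request distribution. -/

noncomputable section

namespace OnlineRA

/-- A request: option `k` consumes `use i k` of resource `i` and yields `profit i k` of profit
type `i`. -/
structure Request (n : ℕ) (K : Type*) where
  use : Fin n → K → ℝ
  profit : Fin n → K → ℝ

/-- Consumption of resource `i` when the request is served by `o`; the extra option `none`
(serve by no option at all) consumes nothing. -/
def Request.useOf {n : ℕ} {K : Type*} (q : Request n K) (i : Fin n) (o : Option K) : ℝ :=
  o.elim 0 (q.use i)

/-- Profit of type `i` when the request is served by `o`; the extra option `none` yields nothing. -/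
def Request.profitOf {n : ℕ} {K : Type*} (q : Request n K) (i : Fin n) (o : Option K) : ℝ :=
  o.elim 0 (q.profit i)

/-- Fractional solutions: every request is served to total extent at most one. -/
def IsFractionalAssignment {J K : Type*} [Fintype K] (x : J → K → ℝ) : Prop :=
  (∀ j k, 0 ≤ x j k) ∧ ∀ j, ∑ k, x j k ≤ 1

/-- `W_E`: the optimal value of the linear program of the expected instance, for `m` i.i.d. requests
that equal `req j` with probability `p j`, and capacities `c`. -/
def expectedOpt {n : ℕ} {J K : Type*} [Fintype K] (m : ℕ) (c : Fin n → ℝ)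
    (req : J → Request n K) (p : PMF J) : ℝ :=
  sSup {v : ℝ | ∃ x : J → K → ℝ, IsFractionalAssignment x ∧
    (∀ i, ∑' j, ∑ k, (m : ℝ) * (p j).toReal * (req j).use i k * x j k ≤ c i) ∧
    ∀ i, v ≤ ∑' j, ∑ k, (m : ℝ) * (p j).toReal * (req j).profit i k * x j k}

/-- The optimal value of the linear program of the instance that consists of the requests in the
list `q`, with capacities `b`. -/
def sampleOpt {n : ℕ} {K : Type*} [Fintype K] (b : Fin n → ℝ) (q : List (Request n K)) : ℝ :=
  sSup {v : ℝ | ∃ x : Fin q.length → K → ℝ, IsFractionalAssignment x ∧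
    (∀ i, ∑ j, ∑ k, (q.get j).use i k * x j k ≤ b i) ∧
    ∀ i, v ≤ ∑ j, ∑ k, (q.get j).profit i k * x j k}

/-- What the algorithm is told in advance: capacities, number of requests, the significance
parameter `γ`, the bound `wmax` on the profit of an option, and the error parameter `ε`. -/
structure Input (n : ℕ) where
  c : Fin n → ℝ
  m : ℕ
  γ : ℝ
  wmax : ℝ
  ε : ℝ

namespace Input

variable {n : ℕ} (I : Input n)

/-- The failure probability `δ = ε / (3 l)`, where `l = log₂ (1 / ε)` is the number of stages. -/
def δ : ℝ := I.ε / (3 * Real.logb 2 (1 / I.ε))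

/-- The length `ε m` of the initial stage `-1`. -/
def firstLen : ℕ := ⌊I.ε * I.m⌋₊

/-- The length `t_r = ε m 2 ^ r` of stage `r ≥ 0`. Stage `r` serves the requests number
`t_r + 1, …, t_{r+1}`, so that `t_r` is also the number of requests that precede it. -/
def len (r : ℕ) : ℕ := I.firstLen * 2 ^ r

/-- The length `t_{r-1}` of the stage before stage `r`, where `t_{-1} = ε m`. -/
def prevLen (r : ℕ) : ℕ := if r = 0 then I.firstLen else I.len (r - 1)

/-- The number of requests that precede the stage before stage `r`. -/
def prevStart (r : ℕ) : ℕ := if r = 0 then 0 else I.len (r - 1)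

/-- The error parameter `ε_x = √(4 γ m ln (2 n / δ) / t)` of a stage of length `t`. -/
def epsX (t : ℕ) : ℝ := √(4 * I.γ * I.m * Real.log (2 * n / I.δ) / t)

/-- The error parameter `ε_y = √(2 w_max m ln (2 n / δ) / (t Z))` of a stage of length `t` with
estimate `Z`. -/
def epsY (t : ℕ) (Z : ℝ) : ℝ := √(2 * I.wmax * I.m * Real.log (2 * n / I.δ) / (t * Z))

/-- The estimate `Z_r` of `W_E` from the requests `past` seen before stage `r`: with `e` the
fractional optimum of the requests of the previous stage, capacities scaled by `t_{r-1} / m`, it is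
`e / (1 + ε_x) * (m / t_{r-1})`. -/
def estimate {K : Type*} [Fintype K] (r : ℕ) (past : List (Request n K)) : ℝ :=
  sampleOpt (fun i => I.prevLen r * I.c i / I.m) ((past.drop (I.prevStart r)).take (I.prevLen r))
    / (1 + I.epsX (I.prevLen r)) * (I.m / I.prevLen r)

/-- The weights `φ_x` of the resources and `φ_y` of the profit types. -/
structure Weights (n : ℕ) where
  x : Fin n → ℝ
  y : Fin n → ℝ

/-- The weights at the beginning of a stage of length `t` with estimate `Z`. One step of an optimal
oblivious policy has expected consumption at most `c i / m`, that is `1 / (m γ)` in units of the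
largest possible consumption `γ * c i`, and expected profit at least `Z / m`, that is
`Z / (m w_max)` in units of `w_max`. -/
def initWeights (t : ℕ) (Z : ℝ) : Weights n where
  x i := I.epsX t / (I.γ * I.c i) *
    ((1 + I.epsX t / (I.m * I.γ)) ^ (t - 1)
      / (1 + I.epsX t) ^ ((1 + I.epsX t) * (t / (I.m * I.γ))))
  y _ := I.epsY t Z / I.wmax *
    ((1 - I.epsY t Z * Z / (I.m * I.wmax)) ^ (t - 1)
      / (1 - I.epsY t Z) ^ ((1 - I.epsY t Z) * (t * Z / (I.m * I.wmax))))

/-- The quantity that the chosen option minimizes. -/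
def score {K : Type*} (φ : Weights n) (q : Request n K) (o : Option K) : ℝ :=
  ∑ i, q.useOf i o * φ.x i - ∑ i, q.profitOf i o * φ.y i

/-- The multiplicative update of the weights after request `q` has been served by `o`. -/
def updateWeights {K : Type*} (t : ℕ) (Z : ℝ) (φ : Weights n) (q : Request n K) (o : Option K) :
    Weights n where
  x i := φ.x i *
    ((1 + I.epsX t) ^ (q.useOf i o / (I.γ * I.c i)) / (1 + I.epsX t / (I.m * I.γ)))
  y i := φ.y i *
    ((1 - I.epsY t Z) ^ (q.profitOf i o / I.wmax) / (1 - I.epsY t Z * Z / (I.m * I.wmax)))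

/-- The weights in a stage of length `t` with estimate `Z` after the requests `q` of this stage have
been served; `sel` selects a minimizer of a function of the option. -/
def stageWeights {K : Type*} (sel : (Option K → ℝ) → Option K) (t : ℕ) (Z : ℝ)
    (q : List (Request n K)) : Weights n :=
  q.foldl (fun φ a => I.updateWeights t Z φ a (sel (score φ a))) (I.initWeights t Z)

/-- The algorithm: the option by which it serves the request `cur`, given the list `past` of the
requests that arrived before. In stage `-1` nothing is served. -/
def decision {K : Type*} [Fintype K] (sel : (Option K → ℝ) → Option K)
    (past : List (Request n K)) (cur : Request n K) : Option K :=
  if past.length < I.firstLen then none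
  else
    let r : ℕ := Nat.log 2 (past.length / I.firstLen)
    sel (score
      (I.stageWeights sel (I.len r) (I.estimate r past) (past.drop (I.len r))) cur)

/-- The option by which the algorithm serves the `t`-th request of the sequence `R`. -/
def served {K : Type*} [Fintype K] (sel : (Option K → ℝ) → Option K)
    (R : Fin I.m → Request n K) (t : Fin I.m) : Option K :=
  I.decision sel ((List.ofFn R).take t) (R t)

/-- On the request sequence `R` the algorithm respects all capacities and attains at least the
objective value `v` (the minimum of the total profits over all types). -/
def Achieves {K : Type*} [Fintype K] (sel : (Option K → ℝ) → Option K)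
    (R : Fin I.m → Request n K) (v : ℝ) : Prop :=
  (∀ i, ∑ t, (R t).useOf i (I.served sel R t) ≤ I.c i) ∧
    ∀ i, v ≤ ∑ t, (R t).profitOf i (I.served sel R t)

end Input

end OnlineRA

end

/-! Write W for W_E. An optimal solution x of the expected program is an oblivious policy: serving a
request j by option k with probability x_jk uses at most c_i/m of each resource and earns at least
W/m of each profit per step, in expectation. Over a stage of t requests, Chernoff bounds control the
chance that it uses more than (1+ε_x) t c_i/m or, for an estimate Z ≤ W, earns less than (1-ε_y) t
Z/m. The algorithm derandomizes this policy without knowing x. Its `potential` is the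
exponential-moment bound on failure if all remaining requests of the stage were served by x. By
Bernoulli's inequality (1+s)^u ≤ 1+su for 0 ≤ u ≤ 1, the potential after one more request is at most
a constant plus the `score` of the chosen option. The minimizer scores no worse than x, and for x
the expectation returns at most the present potential. So the potential is a supermartingale
(`StageParams.lintegral_potential_update_le`). It starts below the Chernoff bound and is at least 1
on failure, which bounds the failure probability of a stage (`StageParams.iidProb_stageFailure_le`).

The estimate Z is good by duality (`iidProb_estimateFailure_le`). From below, x/(1+ε_x) is feasible
on the sample with high probability. From above, a dual solution of the expected program is also
feasible for the dual of the sample; its value there is a constant plus a sum of i.i.d. gains ρ in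
[0, w_max], which concentrates. The expected program may have infinitely many variables; its optimum
is attained by compactness, and the dual solution comes from Hahn-Banach separation.

For the assembly, each of the l stages fails with probability at most 2δ (estimate) plus δ
(service), in total 3lδ = ε. The errors ε_{x,r} decay like 2^(-r/2) while the lengths double, so the
length-weighted errors form a geometric sum of order ε (`sum_epsX_le`). The idle stage -1 leaves ε
c_i of each capacity in reserve, which absorbs the overuse; the profit loses only O(ε) W. -/

open MeasureTheory
open scoped ENNReal

namespace OnlineRA

/-! ### Expectations over i.i.d. samples, as iterated integrals over lists -/

section IID

variable {J : Type*} [MeasurableSpace J]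

/-- The expectation of a function of a list of `s` independent samples of `μ`. -/
noncomputable def iidExp (μ : Measure J) : ℕ → (List J → ℝ≥0∞) → ℝ≥0∞
  | 0, f => f []
  | s + 1, f => ∫⁻ j, iidExp μ s (fun q => f (j :: q)) ∂μ

/-- The probability that a list of `s` independent samples of `μ` lies in `S`. -/
noncomputable def iidProb (μ : Measure J) (s : ℕ) (S : Set (List J)) : ℝ≥0∞ :=
  iidExp μ s (S.indicator 1)

theorem iidExp_mono (μ : Measure J) {s : ℕ} {f g : List J → ℝ≥0∞}
    (h : ∀ q, q.length = s → f q ≤ g q) : iidExp μ s f ≤ iidExp μ s g := by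
  induction s generalizing f g with
  | zero => exact h [] rfl
  | succ s ih => exact lintegral_mono fun j => ih fun q hq => h (j :: q) (by simp [hq])

theorem iidExp_const (μ : Measure J) [IsProbabilityMeasure μ] (s : ℕ) (c : ℝ≥0∞) :
    iidExp μ s (fun _ => c) = c := by
  induction s with
  | zero => rfl
  | succ s ih => simp [iidExp, ih]

theorem iidExp_append (μ : Measure J) (s t : ℕ) (f : List J → ℝ≥0∞) :
    iidExp μ (s + t) f = iidExp μ s (fun q => iidExp μ t (fun q' => f (q ++ q'))) := by
  induction s generalizing f with
  | zero => simp [iidExp]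
  | succ s ih =>
    rw [Nat.succ_add_eq_add_succ, Nat.add_succ]
    simp [iidExp, ih]

/-- Expectations of a supermartingale do not increase. -/
theorem iidExp_le_of_supermartingale (μ : Measure J) (V : List J → ℝ≥0∞)
    (hV : ∀ q, ∫⁻ j, V (q ++ [j]) ∂μ ≤ V q) (s : ℕ) : iidExp μ s V ≤ V [] := by
  suffices H : ∀ q₀, iidExp μ s (fun q => V (q₀ ++ q)) ≤ V q₀ by simpa using H []
  induction s with
  | zero => intro q₀; simp [iidExp]
  | succ s ih =>
    intro q₀
    refine le_trans (lintegral_mono fun j => ?_) (hV q₀)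
    simpa using ih (q₀ ++ [j])

theorem iidProb_mono (μ : Measure J) {s : ℕ} {S T : Set (List J)}
    (h : ∀ q, q.length = s → q ∈ S → q ∈ T) : iidProb μ s S ≤ iidProb μ s T :=
  iidExp_mono μ fun q hq => by
    by_cases hS : q ∈ S
    · simp [hS, h q hq hS]
    · simp [hS]

theorem iidProb_le_iidExp (μ : Measure J) {s : ℕ} {S : Set (List J)} {f : List J → ℝ≥0∞}
    (h : ∀ q, q.length = s → q ∈ S → 1 ≤ f q) : iidProb μ s S ≤ iidExp μ s f :=
  iidExp_mono μ fun q hq => by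
    by_cases hS : q ∈ S
    · simp [hS, h q hq hS]
    · simp [hS]

theorem iidProb_append (μ : Measure J) (s t : ℕ) (S : Set (List J)) :
    iidProb μ (s + t) S = iidExp μ s (fun q => iidProb μ t {q' | q ++ q' ∈ S}) :=
  iidExp_append μ s t _

/-- An event that has conditional probability at most `c` given the first `s` samples. -/
theorem iidProb_append_le (μ : Measure J) [IsProbabilityMeasure μ] {s t : ℕ} {S : Set (List J)}
    {c : ℝ≥0∞} (h : ∀ q, q.length = s → iidProb μ t {q' | q ++ q' ∈ S} ≤ c) :
    iidProb μ (s + t) S ≤ c := by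
  rw [iidProb_append]
  exact (iidExp_mono μ h).trans_eq (iidExp_const μ s c)

/-- Events that depend on the first samples only. -/
theorem iidProb_take (μ : Measure J) [IsProbabilityMeasure μ] (s t : ℕ) (S : Set (List J)) :
    iidProb μ (s + t) {q | q.take s ∈ S} = iidProb μ s S := by
  rw [iidProb_append]
  refine le_antisymm (iidExp_mono μ fun q hq => ?_) (iidExp_mono μ fun q hq => ?_) <;>
  · by_cases hS : q ∈ S <;> simp [iidProb, iidExp_const, ← hq, hS, Pi.one_def]

/-- Events that depend on consecutive samples only. -/
theorem iidProb_drop_take_le (μ : Measure J) [IsProbabilityMeasure μ] {a b m : ℕ} (h : a + b ≤ m)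
    (S : Set (List J)) : iidProb μ m {q | (q.drop a).take b ∈ S} ≤ iidProb μ b S := by
  obtain ⟨d, rfl⟩ := Nat.exists_eq_add_of_le h
  rw [add_assoc]
  refine iidProb_append_le μ fun q hq => ?_
  rw [← iidProb_take μ b d S]
  exact iidProb_mono μ fun q' _ => by simp [← hq]

variable [DiscreteMeasurableSpace J]

theorem iidExp_add (μ : Measure J) (s : ℕ) (f g : List J → ℝ≥0∞) :
    iidExp μ s (fun q => f q + g q) = iidExp μ s f + iidExp μ s g := by
  induction s generalizing f g with
  | zero => rfl
  | succ s ih =>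
    simp only [iidExp, ih]
    exact lintegral_add_left .of_discrete _

theorem iidProb_union_le (μ : Measure J) (s : ℕ) (S T : Set (List J)) :
    iidProb μ s (S ∪ T) ≤ iidProb μ s S + iidProb μ s T := by
  unfold iidProb
  rw [← iidExp_add]
  refine iidExp_mono μ fun q _ => ?_
  by_cases hS : q ∈ S <;> by_cases hT : q ∈ T <;> simp [hS, hT]

theorem iidProb_iUnion_le {ι : Type*} (μ : Measure J) (s : ℕ) (A : Finset ι)
    (S : ι → Set (List J)) :
    iidProb μ s (⋃ i ∈ A, S i) ≤ ∑ i ∈ A, iidProb μ s (S i) := by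
  classical
  induction A using Finset.induction_on with
  | empty =>
    refine (iidProb_mono (T := ∅) μ fun q _ h => by simp at h).trans ?_
    refine le_of_eq ?_
    simp only [iidProb, Set.indicator_empty, Finset.sum_empty]
    induction s with
    | zero => rfl
    | succ s ih => simp [iidExp, ih]
  | insert a A ha ih =>
    rw [Finset.set_biUnion_insert, Finset.sum_insert ha]
    exact (iidProb_union_le μ s _ _).trans (by gcongr)

variable [Countable J]

/-- Splitting off the first coordinate of the product measure reproduces the recursion of `iidExp`.
The probabilistic argument can thus be carried out on lists and transferred to the product measure
once. -/
theorem lintegral_pi_ofFn (μ : Measure J) [IsProbabilityMeasure μ] (s : ℕ)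
    (f : List J → ℝ≥0∞) :
    ∫⁻ R, f (List.ofFn R) ∂Measure.pi (fun _ : Fin s => μ) = iidExp μ s f := by
  induction s generalizing f with
  | zero => simp [iidExp]
  | succ s ih =>
    have hp := (measurePreserving_piFinSuccAbove (fun _ : Fin (s + 1) => μ) 0).symm
    rw [← hp.lintegral_comp (by exact .of_discrete), lintegral_prod _ (by exact .of_discrete)]
    simp only [iidExp]
    refine lintegral_congr fun j => ?_
    rw [← ih]
    refine lintegral_congr fun R => ?_
    simp [List.ofFn_succ, MeasurableEquiv.piFinSuccAbove]

theorem pi_ofFn_mem (μ : Measure J) [IsProbabilityMeasure μ] (s : ℕ) (S : Set (List J)) :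
    Measure.pi (fun _ : Fin s => μ) {R | List.ofFn R ∈ S} = iidProb μ s S := by
  rw [iidProb, ← lintegral_pi_ofFn, ← lintegral_indicator_one .of_discrete]
  rfl

end IID

/-! ### Chernoff bounds -/

section Tails

/-- Uses log(1+ε) ≥ 2ε/(2+ε). The deviation is measured by μ and not by the mean bound μ', because
the dual gains may have a mean much smaller than the scale W/m of the admissible error. -/
theorem upper_tail_bound {ε μ' μ : ℝ} (hε : 0 < ε) (hμ' : 0 ≤ μ') (hμ : μ' ≤ μ) (t : ℕ) :
    (1 + ε * μ') ^ t / (1 + ε) ^ (t * μ' + ε * (t * μ))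
      ≤ Real.exp (-(ε ^ 2 / (2 + ε) * (t * μ))) := by
  have h1 : (1 + ε * μ') ^ t ≤ Real.exp (t * (ε * μ')) := by
    rw [Real.exp_nat_mul]
    have := mul_nonneg hε.le hμ'
    gcongr
    linarith [Real.add_one_le_exp (ε * μ')]
  have hl := Real.le_log_one_add_of_nonneg hε.le
  have hl2 : Real.log (1 + ε) ≤ ε := by
    linarith [Real.log_le_sub_one_of_pos (show 0 < 1 + ε by linarith)]
  rw [Real.rpow_def_of_pos (by linarith), div_le_iff₀ (Real.exp_pos _), ← Real.exp_add]
  refine h1.trans (Real.exp_le_exp.2 ?_)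
  have h2 : (t : ℝ) * μ' * (ε - Real.log (1 + ε)) ≤ t * μ * (ε - Real.log (1 + ε)) := by
    have : 0 ≤ ε - Real.log (1 + ε) := by linarith
    gcongr
  have h3 : ε + ε ^ 2 / (2 + ε) ≤ (1 + ε) * Real.log (1 + ε) := by
    refine le_trans (le_of_eq ?_) (mul_le_mul_of_nonneg_left hl (by linarith : 0 ≤ 1 + ε))
    field_simp
    ring
  have h4 := mul_le_mul_of_nonneg_left h3 (mul_nonneg t.cast_nonneg (hμ'.trans hμ) : 0 ≤ (t : ℝ) * μ)
  linarith

/-- This is y ≤ sinh y at y = log(1/u), multiplied by u. -/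
theorem sq_sub_one_div_two_le_mul_log {u : ℝ} (h0 : 0 < u) (h1 : u ≤ 1) :
    (u ^ 2 - 1) / 2 ≤ u * Real.log u := by
  have h := Real.self_le_sinh_iff.2 (Real.log_nonneg ((one_le_inv₀ h0).2 h1))
  rw [Real.sinh_log (inv_pos.2 h0), Real.log_inv, inv_inv] at h
  have := mul_le_mul_of_nonneg_left h h0.le
  have h2 : u * ((u⁻¹ - u) / 2) = (1 - u ^ 2) / 2 := by field_simp
  linarith

theorem lower_tail_bound {ε μ : ℝ} (hε : 0 < ε) (hε1 : ε < 1) (hμ : 0 ≤ μ) (hεμ : ε * μ ≤ 1)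
    (t : ℕ) :
    (1 - ε * μ) ^ t / (1 - ε) ^ ((1 - ε) * (t * μ)) ≤ Real.exp (-(ε ^ 2 / 2 * (t * μ))) := by
  have h1 : (1 - ε * μ) ^ t ≤ Real.exp (t * (-(ε * μ))) := by
    rw [Real.exp_nat_mul]
    have : 0 ≤ 1 - ε * μ := by linarith
    gcongr
    linarith [Real.add_one_le_exp (-(ε * μ))]
  have hl := sq_sub_one_div_two_le_mul_log (show 0 < 1 - ε by linarith) (by linarith)
  rw [Real.rpow_def_of_pos (by linarith), div_le_iff₀ (Real.exp_pos _), ← Real.exp_add]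
  refine h1.trans (Real.exp_le_exp.2 ?_)
  have h4 := mul_le_mul_of_nonneg_left hl (mul_nonneg t.cast_nonneg hμ : 0 ≤ (t : ℝ) * μ)
  linarith

variable {J : Type*} [MeasurableSpace J] [DiscreteMeasurableSpace J]

/-- The exponential moment method for sums of independent identically distributed variables. -/
theorem iidProb_le_of_moment (P : Measure J) [IsProbabilityMeasure P] {a b κ : ℝ}
    (ha : 0 < a) (hb : 0 < b) (hκ : 0 ≤ κ) {X : J → ℝ}
    (hX : ∫⁻ j, ENNReal.ofReal (a ^ X j) ∂P ≤ ENNReal.ofReal b) (t : ℕ) (S : Set (List J))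
    (hS : ∀ q ∈ S, q.length = t → b ^ t ≤ κ * a ^ (q.map X).sum) :
    iidProb P t S ≤ ENNReal.ofReal κ := by
  -- Each sample multiplies V by a^X / b, whose expectation is at most 1.
  set V : List J → ℝ≥0∞ := fun q => ENNReal.ofReal (κ * (a ^ (q.map X).sum / b ^ q.length)) with hV
  have hsup : ∀ q, ∫⁻ j, V (q ++ [j]) ∂P ≤ V q := by
    intro q
    have h1 : ∀ j, V (q ++ [j]) = ENNReal.ofReal (κ * (a ^ (q.map X).sum / b ^ (q.length + 1)))
        * ENNReal.ofReal (a ^ X j) := by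
      intro j
      rw [hV, ← ENNReal.ofReal_mul (by positivity)]
      simp only [List.map_append, List.map_cons, List.map_nil, List.sum_append, List.sum_cons,
        List.sum_nil, add_zero, List.length_append, List.length_cons, List.length_nil, zero_add,
        Real.rpow_add ha]
      congr 1
      ring
    simp only [h1]
    rw [lintegral_const_mul _ .of_discrete]
    refine (mul_le_mul_right hX _).trans ?_
    rw [← ENNReal.ofReal_mul (by positivity), hV]
    refine ENNReal.ofReal_le_ofReal (le_of_eq ?_)
    rw [pow_succ]
    field_simp
  refine (iidProb_le_iidExp P (f := V) fun q hq hqS => ?_).trans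
    ((iidExp_le_of_supermartingale P V hsup t).trans (by simp [hV]))
  rw [hV, ENNReal.one_le_ofReal, ← mul_div_assoc, hq, one_le_div (by positivity)]
  exact hS q hqS hq

variable [Countable J]

/-- The exponential moment of a variable with values in the unit interval. -/
theorem lintegral_rpow_le (P : Measure J) [IsProbabilityMeasure P] {X : J → ℝ}
    (h0 : ∀ j, 0 ≤ X j) (h1 : ∀ j, X j ≤ 1) {s : ℝ} (hs : -1 < s) :
    ∫⁻ j, ENNReal.ofReal ((1 + s) ^ X j) ∂P ≤ ENNReal.ofReal (1 + s * ∫ j, X j ∂P) := by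
  have hi : Integrable X P := .of_bound .of_discrete 1 (.of_forall fun j => by
    rw [Real.norm_of_nonneg (h0 j)]; exact h1 j)
  have h2 : (1 + s * ∫ j, X j ∂P) = ∫ j, (1 + X j * s) ∂P := by
    rw [integral_add (integrable_const _) (hi.mul_const _), integral_mul_const]
    simp [mul_comm]
  have h3 : ∀ j, (1 + s) ^ X j ≤ 1 + X j * s := fun j =>
    rpow_one_add_le_one_add_mul_self hs.le (h0 j) (h1 j)
  have h4 : Integrable (fun j => 1 + X j * s) P := (integrable_const _).add (hi.mul_const _)
  rw [h2, ofReal_integral_eq_lintegral_ofReal h4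
    (.of_forall fun j => le_trans (Real.rpow_nonneg (by linarith) _) (h3 j))]
  exact lintegral_mono fun j => ENNReal.ofReal_le_ofReal (h3 j)

theorem iidProb_upper_tail (P : Measure J) [IsProbabilityMeasure P] {X : J → ℝ}
    (h0 : ∀ j, 0 ≤ X j) (h1 : ∀ j, X j ≤ 1) {ε μ' μ : ℝ} (hε : 0 < ε)
    (hX : ∫ j, X j ∂P ≤ μ') (hμ : μ' ≤ μ) (t : ℕ) :
    iidProb P t {q | t * μ' + ε * (t * μ) ≤ (q.map X).sum}
      ≤ ENNReal.ofReal (Real.exp (-(ε ^ 2 / (2 + ε) * (t * μ)))) := by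
  have hμ' : 0 ≤ μ' := (integral_nonneg h0).trans hX
  refine le_trans ?_ (ENNReal.ofReal_le_ofReal (upper_tail_bound hε hμ' hμ t))
  have hb : 0 < 1 + ε * μ' := by positivity
  have ha : 0 < 1 + ε := by linarith
  -- Here a = 1 + ε, b = 1 + ε μ', and κ = b^t / a^s with s the threshold of the event.
  refine iidProb_le_of_moment P ha hb (by positivity)
    ((lintegral_rpow_le P h0 h1 (by linarith)).trans (ENNReal.ofReal_le_ofReal (by gcongr)))
    t _ fun q hq _ => ?_
  rw [div_mul_eq_mul_div, le_div_iff₀ (by positivity)]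
  gcongr
  · linarith
  · exact hq

theorem iidProb_lower_tail (P : Measure J) [IsProbabilityMeasure P] {X : J → ℝ}
    (h0 : ∀ j, 0 ≤ X j) (h1 : ∀ j, X j ≤ 1) {ε μ : ℝ} (hε : 0 < ε) (hε1 : ε < 1)
    (hμ0 : 0 ≤ μ) (hX : μ ≤ ∫ j, X j ∂P) (t : ℕ) :
    iidProb P t {q | (q.map X).sum ≤ (1 - ε) * (t * μ)}
      ≤ ENNReal.ofReal (Real.exp (-(ε ^ 2 / 2 * (t * μ)))) := by
  have hμ1 : μ ≤ 1 := hX.trans (by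
    have := integral_mono_of_nonneg (.of_forall h0) (integrable_const (1 : ℝ)) (.of_forall h1)
      (μ := P)
    simpa using this)
  have hεμ : ε * μ < 1 := by nlinarith
  refine le_trans ?_ (ENNReal.ofReal_le_ofReal (lower_tail_bound hε hε1 hμ0 hεμ.le t))
  have hb : 0 < 1 - ε * μ := by linarith
  have ha : 0 < 1 - ε := by linarith
  have hm := lintegral_rpow_le P h0 h1 (s := -ε) (by linarith)
  rw [← sub_eq_add_neg] at hm
  refine iidProb_le_of_moment P ha hb (by positivity)
    (hm.trans (ENNReal.ofReal_le_ofReal (by nlinarith)))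
    t _ fun q hq _ => ?_
  rw [div_mul_eq_mul_div, le_div_iff₀ (by positivity)]
  -- The base 1 - ε lies below 1, so a small sum means a large power.
  exact mul_le_mul_of_nonneg_left (Real.rpow_le_rpow_of_exponent_ge ha (by linarith) hq)
    (by positivity)

end Tails

/-! ### The expected linear program: attainment and duality -/

section LP

variable {n : ℕ} {J K : Type*} [Fintype K]

theorem IsFractionalAssignment.sum_mul_le {x : J → K → ℝ} (hx : IsFractionalAssignment x)
    {F : J → K → ℝ} {B : ℝ} (hB : 0 ≤ B) (hF : ∀ j k, F j k ≤ B) (j : J) :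
    ∑ k, F j k * x j k ≤ B :=
  calc ∑ k, F j k * x j k ≤ ∑ k, B * x j k :=
        Finset.sum_le_sum fun k _ => mul_le_mul_of_nonneg_right (hF j k) (hx.1 j k)
    _ = B * ∑ k, x j k := by rw [Finset.mul_sum]
    _ ≤ B * 1 := mul_le_mul_of_nonneg_left (hx.2 j) hB
    _ = B := mul_one B

theorem IsFractionalAssignment.sum_mul_nonneg {x : J → K → ℝ} (hx : IsFractionalAssignment x)
    {F : J → K → ℝ} (hF : ∀ j k, 0 ≤ F j k) (j : J) : 0 ≤ ∑ k, F j k * x j k :=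
  Finset.sum_nonneg fun k _ => mul_nonneg (hF j k) (hx.1 j k)

theorem IsFractionalAssignment.norm_sum_mul_le {x : J → K → ℝ} (hx : IsFractionalAssignment x)
    {F : J → K → ℝ} {B : ℝ} (hB : 0 ≤ B) (h0 : ∀ j k, 0 ≤ F j k) (hF : ∀ j k, F j k ≤ B) (j : J) :
    ‖∑ k, F j k * x j k‖ ≤ B := by
  rw [Real.norm_of_nonneg (hx.sum_mul_nonneg h0 j)]
  exact hx.sum_mul_le hB hF j

theorem IsFractionalAssignment.zero : IsFractionalAssignment (0 : J → K → ℝ) := by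
  constructor <;> simp

theorem IsFractionalAssignment.convex :
    Convex ℝ {x : J → K → ℝ | IsFractionalAssignment x} := by
  intro x hx y hy a b ha hb hab
  refine ⟨fun j k => ?_, fun j => ?_⟩
  · have := hx.1 j k
    have := hy.1 j k
    simp only [Pi.add_apply, Pi.smul_apply, smul_eq_mul]
    positivity
  · simp only [Pi.add_apply, Pi.smul_apply, smul_eq_mul, Finset.sum_add_distrib,
      ← Finset.mul_sum]
    nlinarith [hx.2 j, hy.2 j]

/-- Tychonoff: a product over J of compact sets of subprobability vectors on K. -/
theorem IsFractionalAssignment.isCompact :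
    IsCompact {x : J → K → ℝ | IsFractionalAssignment x} := by
  have h : {x : J → K → ℝ | IsFractionalAssignment x}
      = Set.univ.pi fun _ => {y : K → ℝ | (∀ k, 0 ≤ y k) ∧ ∑ k, y k ≤ 1} := by
    ext x
    simp [IsFractionalAssignment, forall_and]
  rw [h]
  refine isCompact_univ_pi fun _ => (isCompact_Icc (a := (0 : K → ℝ)) (b := 1)).of_isClosed_subset
    ?_ fun y hy => ⟨fun k => hy.1 k, fun k => ?_⟩
  · have h1 : IsClosed {y : K → ℝ | ∀ k, 0 ≤ y k} := isClosed_Ici (a := (0 : K → ℝ))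
    have h2 : IsClosed {y : K → ℝ | ∑ k, y k ≤ 1} :=
      isClosed_le (continuous_finsetSum _ fun k _ => continuous_apply k) continuous_const
    exact h1.inter h2
  · exact (Finset.single_le_sum (fun k _ => hy.1 k) (Finset.mem_univ k)).trans hy.2

variable [Countable J] [MeasurableSpace J] [DiscreteMeasurableSpace J]

theorem IsFractionalAssignment.integrable {x : J → K → ℝ} (hx : IsFractionalAssignment x)
    {F : J → K → ℝ} {B : ℝ} (hB : 0 ≤ B) (h0 : ∀ j k, 0 ≤ F j k) (hF : ∀ j k, F j k ≤ B)
    (P : Measure J) [IsProbabilityMeasure P] : Integrable (fun j => ∑ k, F j k * x j k) P :=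
  .of_bound .of_discrete B (.of_forall (hx.norm_sum_mul_le hB h0 hF))

/-- Dominated convergence with the constant bound B; countability of J makes the product topology
first countable. -/
theorem continuousOn_integral_assignment {F : J → K → ℝ} {B : ℝ} (hB : 0 ≤ B)
    (h0 : ∀ j k, 0 ≤ F j k) (hF : ∀ j k, F j k ≤ B) (P : Measure J) [IsProbabilityMeasure P] :
    ContinuousOn (fun x : J → K → ℝ => ∫ j, ∑ k, F j k * x j k ∂P)
      {x | IsFractionalAssignment x} := by
  refine continuousOn_of_dominated (bound := fun _ => B) (fun x _ => .of_discrete)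
    (fun x hx => .of_forall (IsFractionalAssignment.norm_sum_mul_le hx hB h0 hF))
    (integrable_const _) (.of_forall fun j => ?_)
  fun_prop

theorem tsum_assignment_eq {x : J → K → ℝ} (hx : IsFractionalAssignment x)
    {F : J → K → ℝ} {B : ℝ} (hB : 0 ≤ B) (h0 : ∀ j k, 0 ≤ F j k) (hF : ∀ j k, F j k ≤ B)
    (p : PMF J) (m : ℕ) :
    ∑' j, ∑ k, (m : ℝ) * (p j).toReal * F j k * x j k
      = m * ∫ j, ∑ k, F j k * x j k ∂p.toMeasure := by
  rw [PMF.integral_eq_tsum _ _ (hx.integrable hB h0 hF _), ← tsum_mul_left]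
  refine tsum_congr fun j => ?_
  rw [smul_eq_mul, ← mul_assoc, Finset.mul_sum]
  exact Finset.sum_congr rfl fun k _ => by ring

/-- The standing assumptions on the requests: consumption and profit are nonnegative and bounded. -/
structure Bounded (req : J → Request n K) (A : Fin n → ℝ) (w : ℝ) : Prop where
  use_nonneg : ∀ j i k, 0 ≤ (req j).use i k
  profit_nonneg : ∀ j i k, 0 ≤ (req j).profit i k
  use_le : ∀ j i k, (req j).use i k ≤ A i
  profit_le : ∀ j i k, (req j).profit i k ≤ w
  A_nonneg : ∀ i, 0 ≤ A i
  w_nonneg : 0 ≤ w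

/-- The optimum of the expected instance is attained, and it is an upper bound. -/
theorem exists_optimal_assignment (hn : 1 ≤ n) {c : Fin n → ℝ} (hc : ∀ i, 0 < c i)
    {req : J → Request n K} {A : Fin n → ℝ} {w : ℝ} (hb : Bounded req A w) (p : PMF J) (m : ℕ) :
    (∃ x, IsFractionalAssignment x ∧
      (∀ i, m * ∫ j, ∑ k, (req j).use i k * x j k ∂p.toMeasure ≤ c i) ∧
      ∀ i, expectedOpt m c req p ≤ m * ∫ j, ∑ k, (req j).profit i k * x j k ∂p.toMeasure) ∧
    ∀ x v, IsFractionalAssignment x →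
      (∀ i, m * ∫ j, ∑ k, (req j).use i k * x j k ∂p.toMeasure ≤ c i) →
      (∀ i, v ≤ m * ∫ j, ∑ k, (req j).profit i k * x j k ∂p.toMeasure) →
      v ≤ expectedOpt m c req p := by
  set P := p.toMeasure
  set G : Fin n → (J → K → ℝ) → ℝ := fun i x => m * ∫ j, ∑ k, (req j).use i k * x j k ∂P with hG
  set H : Fin n → (J → K → ℝ) → ℝ := fun i x => m * ∫ j, ∑ k, (req j).profit i k * x j k ∂P with hH
  have hset : expectedOpt m c req p = sSup {v : ℝ | ∃ x : J → K → ℝ, IsFractionalAssignment x ∧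
      (∀ i, G i x ≤ c i) ∧ ∀ i, v ≤ H i x} := by
    unfold expectedOpt
    congr 1
    ext v
    refine exists_congr fun x => and_congr_right fun hx => ?_
    have h1 : ∀ i, ∑' j, ∑ k, (m : ℝ) * (p j).toReal * (req j).use i k * x j k = G i x :=
      fun i => tsum_assignment_eq hx (hb.A_nonneg i) (fun j => hb.use_nonneg j i)
        (fun j => hb.use_le j i) p m
    have h2 : ∀ i, ∑' j, ∑ k, (m : ℝ) * (p j).toReal * (req j).profit i k * x j k = H i x :=
      fun i => tsum_assignment_eq hx hb.w_nonneg (fun j => hb.profit_nonneg j i)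
        (fun j => hb.profit_le j i) p m
    simp only [h1, h2]
  have hGc : ∀ i, ContinuousOn (G i) {x | IsFractionalAssignment x} := fun i =>
    (continuousOn_integral_assignment (hb.A_nonneg i) (fun j => hb.use_nonneg j i)
      (fun j => hb.use_le j i) P).const_smul (m : ℝ)
  have hHc : ∀ i, ContinuousOn (H i) {x | IsFractionalAssignment x} := fun i =>
    (continuousOn_integral_assignment hb.w_nonneg (fun j => hb.profit_nonneg j i)
      (fun j => hb.profit_le j i) P).const_smul (m : ℝ)
  have hcomp := IsFractionalAssignment.isCompact (J := J) (K := K)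
  set S : Set (J → K → ℝ) := {x | IsFractionalAssignment x ∧ ∀ i, G i x ≤ c i} with hS
  have hSc : IsCompact S := by
    have : S = {x | IsFractionalAssignment x} ∩ ⋂ i, ({x | IsFractionalAssignment x} ∩
        G i ⁻¹' Set.Iic (c i)) := by
      ext x
      simp only [hS, Set.mem_inter_iff, Set.mem_iInter, Set.mem_ofPred_eq, Set.mem_preimage,
        Set.mem_Iic]
      exact ⟨fun h => ⟨h.1, fun i => ⟨h.1, h.2 i⟩⟩, fun h => ⟨h.1, fun i => (h.2 i).2⟩⟩
    rw [this]
    exact hcomp.inter_right (isClosed_iInter fun i =>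
      (hGc i).preimage_isClosed_of_isClosed hcomp.isClosed isClosed_Iic)
  have h0 : (0 : J → K → ℝ) ∈ S :=
    ⟨IsFractionalAssignment.zero, fun i => by simpa [hG] using (hc i).le⟩
  have hne : (Finset.univ : Finset (Fin n)).Nonempty := ⟨⟨0, hn⟩, Finset.mem_univ _⟩
  obtain ⟨x, hxS, hx⟩ := hSc.exists_isMaxOn ⟨0, h0⟩
    (ContinuousOn.finset_inf' hne fun i _ => (hHc i).mono fun x hx => hx.1)
  have hub : ∀ v ∈ {v : ℝ | ∃ x : J → K → ℝ, IsFractionalAssignment x ∧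
      (∀ i, G i x ≤ c i) ∧ ∀ i, v ≤ H i x}, v ≤ Finset.univ.inf' hne H x := by
    rintro v ⟨y, hy, hyc, hyv⟩
    refine le_trans ?_ (hx ⟨hy, hyc⟩)
    rw [Finset.inf'_apply]
    exact Finset.le_inf' _ _ fun i _ => hyv i
  refine ⟨⟨x, hxS.1, hxS.2, fun i => ?_⟩, fun y v hy hyc hyv => ?_⟩
  · rw [hset]
    refine le_trans (csSup_le ⟨0, 0, IsFractionalAssignment.zero, h0.2, fun i => by simp [hH]⟩
      hub) ?_
    rw [Finset.inf'_apply]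
    exact Finset.inf'_le _ (Finset.mem_univ i)
  · rw [hset]
    refine le_csSup ⟨Finset.univ.inf' hne H x, hub⟩ ⟨y, hy, hyc, hyv⟩

/-- Strong duality for a family of constraints `G i x ≤ c i` that is strictly feasible and of
objectives `H i x`, the least of which cannot exceed `W` on the feasible set. -/
theorem exists_lagrange_multipliers {E : Type*} [AddCommGroup E] [Module ℝ E] {X : Set E}
    (hX : Convex ℝ X) {G H : Fin n → E → ℝ} (hG : ∀ i, ConvexOn ℝ X (G i))
    (hH : ∀ i, ConcaveOn ℝ X (H i)) {c : Fin n → ℝ} {W : ℝ} {x₀ : E} (hx₀ : x₀ ∈ X)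
    (hs : ∀ i, G i x₀ < c i)
    (hW : ∀ x ∈ X, (∀ i, G i x ≤ c i) → ∃ i, H i x ≤ W) :
    ∃ α β : Fin n → ℝ, (∀ i, 0 ≤ α i) ∧ (∀ i, 0 ≤ β i) ∧ ∑ i, β i = 1 ∧
      ∀ x ∈ X, ∑ i, β i * H i x - ∑ i, α i * G i x ≤ W - ∑ i, α i * c i := by
  classical
  -- The pairs (capacities, objectives) that some x beats strictly. Strictness makes U open, and
  -- `hW` keeps (c, W) out of it, so a functional separates them.
  set U : Set ((Fin n → ℝ) × (Fin n → ℝ)) :=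
    {z | ∃ x ∈ X, ∀ i, G i x < z.1 i ∧ z.2 i < H i x} with hU
  have hUo : IsOpen U := by
    have : U = ⋃ x ∈ X, ⋂ i, {z | G i x < z.1 i} ∩ {z | z.2 i < H i x} := by
      ext z
      simp [hU]
    rw [this]
    exact isOpen_biUnion fun x _ => isOpen_iInter_of_finite fun i =>
      (isOpen_lt (by fun_prop) (by fun_prop)).inter (isOpen_lt (by fun_prop) (by fun_prop))
  have hUc : Convex ℝ U := by
    rw [convex_iff_forall_pos]
    rintro z ⟨x, hx, hz⟩ z' ⟨x', hx', hz'⟩ a b ha hb hab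
    refine ⟨a • x + b • x', hX hx hx' ha.le hb.le hab, fun i => ⟨?_, ?_⟩⟩
    · refine ((hG i).2 hx hx' ha.le hb.le hab).trans_lt ?_
      simp only [smul_eq_mul, Prod.fst_add, Prod.smul_fst, Pi.add_apply, Pi.smul_apply]
      have := (hz i).1
      have := (hz' i).1
      gcongr
    · refine lt_of_lt_of_le ?_ ((hH i).2 hx hx' ha.le hb.le hab)
      simp only [smul_eq_mul, Prod.snd_add, Prod.smul_snd, Pi.add_apply, Pi.smul_apply]
      have := (hz i).2
      have := (hz' i).2
      gcongr
  have hnot : ((c, fun _ => W) : (Fin n → ℝ) × (Fin n → ℝ)) ∉ U := by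
    rintro ⟨x, hx, h⟩
    obtain ⟨i, hi⟩ := hW x hx fun i => (h i).1.le
    exact absurd (h i).2 hi.not_gt
  obtain ⟨f, hf⟩ := geometric_hahn_banach_open_point hUc hUo hnot
  set a : Fin n → ℝ := fun i => f (Pi.single i 1, 0) with ha
  set b : Fin n → ℝ := fun i => f (0, Pi.single i 1) with hb
  have hfe : ∀ u v, f (u, v) = ∑ i, u i * a i + ∑ i, v i * b i := by
    intro u v
    have h1 : ((u, v) : (Fin n → ℝ) × (Fin n → ℝ)) = (u, 0) + (0, v) := by simp
    have h2 := LinearMap.pi_apply_eq_sum_univ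
      (f.toLinearMap ∘ₗ LinearMap.inl ℝ (Fin n → ℝ) (Fin n → ℝ)) u
    have h3 := LinearMap.pi_apply_eq_sum_univ
      (f.toLinearMap ∘ₗ LinearMap.inr ℝ (Fin n → ℝ) (Fin n → ℝ)) v
    have hsing : ∀ i : Fin n, (fun j => if i = j then (1 : ℝ) else 0) = Pi.single i 1 := by
      intro i; ext j; simp [Pi.single_apply, eq_comm]
    simp only [hsing] at h2 h3
    rw [h1, map_add]
    exact congrArg₂ (· + ·) h2 h3
  have key : ∀ x ∈ X, ∀ u v : Fin n → ℝ, (∀ i, G i x < u i) → (∀ i, v i < H i x) →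
      ∑ i, u i * a i + ∑ i, v i * b i < ∑ i, c i * a i + W * ∑ i, b i := by
    intro x hx u v hu hv
    have := hf (u, v) ⟨x, hx, fun i => ⟨hu i, hv i⟩⟩
    rwa [hfe, hfe, ← Finset.mul_sum] at this
  -- An affine function bounded above on a half-line has nonpositive slope. As U is closed under
  -- raising capacities and lowering objectives, this fixes the signs of a and b.
  have lim : ∀ A B D : ℝ, (∀ s : ℝ, 0 ≤ s → A + s * B < D) → B ≤ 0 := by
    intro A B D h
    by_contra! hB
    have h0 := h 0 le_rfl
    have := h ((D - A) / B) (div_nonneg (by linarith) hB.le)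
    rw [div_mul_cancel₀ _ hB.ne'] at this
    linarith
  have hsum : ∀ (u d : Fin n → ℝ) (i : Fin n) (s : ℝ),
      ∑ j, (u j + s * (Pi.single i 1 : Fin n → ℝ) j) * d j = ∑ j, u j * d j + s * d i := by
    intro u d i s
    simp [add_mul, Finset.sum_add_distrib, Pi.single_apply]
  have ha0 : ∀ i, a i ≤ 0 := by
    intro i
    refine lim (∑ j, c j * a j + ∑ j, (H j x₀ - 1) * b j) (a i)
      (∑ i, c i * a i + W * ∑ i, b i) fun s hs0 => ?_
    have := key x₀ hx₀ (fun j => c j + s * (Pi.single i 1 : Fin n → ℝ) j) (fun j => H j x₀ - 1)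
      (fun j => (hs j).trans_le (by
        have : (0 : ℝ) ≤ (Pi.single i 1 : Fin n → ℝ) j := by
          rw [Pi.single_apply]; split_ifs <;> norm_num
        nlinarith [mul_nonneg hs0 this])) (fun j => by linarith)
    rw [hsum] at this
    linarith
  have hb0 : ∀ i, 0 ≤ b i := by
    intro i
    have := lim (∑ j, c j * a j + ∑ j, (H j x₀ - 1) * b j) (-b i)
      (∑ i, c i * a i + W * ∑ i, b i) fun s hs0 => by
        have := key x₀ hx₀ c (fun j => (H j x₀ - 1) + (-s) * (Pi.single i 1 : Fin n → ℝ) j) hs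
          (fun j => by
            have : (0 : ℝ) ≤ (Pi.single i 1 : Fin n → ℝ) j := by
              rw [Pi.single_apply]; split_ifs <;> norm_num
            nlinarith [mul_nonneg hs0 this])
        rw [hsum] at this
        linarith
    linarith
  have hlag : ∀ x ∈ X, ∑ i, G i x * a i + ∑ i, H i x * b i ≤ ∑ i, c i * a i + W * ∑ i, b i := by
    intro x hx
    -- The values of x themselves lie only on the boundary of U, so they are moved inside by θ, with
    -- the total effect of the shift equal to η.
    refine le_of_forall_pos_le_add fun η hη => ?_
    have hD : 0 < ∑ i, b i - ∑ i, a i + 1 := by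
      have := Finset.sum_nonneg fun i (_ : i ∈ Finset.univ) => hb0 i
      have := Finset.sum_nonpos fun i (_ : i ∈ Finset.univ) => ha0 i
      linarith
    set θ := η / (∑ i, b i - ∑ i, a i + 1) with hθ
    have hθ0 : 0 < θ := by positivity
    have := key x hx (fun i => G i x + θ) (fun i => H i x - θ) (fun i => by linarith)
      (fun i => by linarith)
    simp only [add_mul, sub_mul, Finset.sum_add_distrib, Finset.sum_sub_distrib,
      ← Finset.mul_sum] at this
    have h2 : θ * (∑ i, b i - ∑ i, a i + 1) = η := div_mul_cancel₀ _ hD.ne'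
    linarith
  -- Slater's condition: if b vanished, separation at the midpoint of G x₀ and c would contradict a
  -- ≤ 0.
  have hB : 0 < ∑ i, b i := by
    refine lt_of_le_of_ne (Finset.sum_nonneg fun i _ => hb0 i) fun h => ?_
    have hz : ∀ i, b i = 0 := fun i =>
      (Finset.sum_eq_zero_iff_of_nonneg fun i _ => hb0 i).1 h.symm i (Finset.mem_univ i)
    have := key x₀ hx₀ (fun i => (G i x₀ + c i) / 2) (fun i => H i x₀ - 1)
      (fun i => by linarith [hs i]) (fun i => by linarith)
    simp only [hz, mul_zero, Finset.sum_const_zero, add_zero] at this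
    refine absurd this (not_lt.2 (Finset.sum_le_sum fun i _ => ?_))
    nlinarith [ha0 i, hs i]
  refine ⟨fun i => -a i / ∑ j, b j, fun i => b i / ∑ j, b j,
    fun i => div_nonneg (neg_nonneg.2 (ha0 i)) hB.le, fun i => div_nonneg (hb0 i) hB.le, ?_,
    fun x hx => ?_⟩
  · rw [← Finset.sum_div, div_self hB.ne']
  · have e1 : ∀ y : Fin n → ℝ, ∑ i, -a i / (∑ j, b j) * y i = -(∑ i, y i * a i) / ∑ j, b j := by
      intro y
      rw [← Finset.sum_neg_distrib, Finset.sum_div]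
      exact Finset.sum_congr rfl fun i _ => by ring
    have e2 : ∑ i, b i / (∑ j, b j) * H i x = (∑ i, H i x * b i) / ∑ j, b j := by
      rw [Finset.sum_div]
      exact Finset.sum_congr rfl fun i _ => by ring
    rw [e1, e1, e2]
    have := hlag x hx
    rw [← sub_div, le_sub_iff_add_le, ← add_div, div_le_iff₀ hB]
    linarith

/-- An optimal dual solution of the linear program of the expected instance: prices `α` of the
resources, weights `β` of the objectives, and the gain `ρ j` of a request of type `j`. -/
theorem exists_dual_solution (hn : 1 ≤ n) {c : Fin n → ℝ} (hc : ∀ i, 0 < c i)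
    {req : J → Request n K} {A : Fin n → ℝ} {w : ℝ} (hb : Bounded req A w) (p : PMF J) (m : ℕ) :
    ∃ (α β : Fin n → ℝ) (ρ : J → ℝ), (∀ i, 0 ≤ α i) ∧ (∀ i, 0 ≤ β i) ∧ ∑ i, β i = 1 ∧
      (∀ j, 0 ≤ ρ j) ∧ (∀ j, ρ j ≤ w) ∧
      (∀ j k, ∑ i, β i * (req j).profit i k - ∑ i, α i * (req j).use i k ≤ ρ j) ∧
      m * ∫ j, ρ j ∂p.toMeasure ≤ expectedOpt m c req p - ∑ i, α i * c i := by
  classical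
  obtain ⟨-, hopt⟩ := exists_optimal_assignment hn hc hb p m
  set P := p.toMeasure
  set W := expectedOpt m c req p
  have hlin : ∀ {F : J → K → ℝ} {B : ℝ}, 0 ≤ B → (∀ j k, 0 ≤ F j k) → (∀ j k, F j k ≤ B) →
      ∀ {x y : J → K → ℝ}, IsFractionalAssignment x → IsFractionalAssignment y → ∀ a b : ℝ,
      (m : ℝ) * ∫ j, ∑ k, F j k * (a • x + b • y) j k ∂P
        = a • (m * ∫ j, ∑ k, F j k * x j k ∂P) + b • (m * ∫ j, ∑ k, F j k * y j k ∂P) := by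
    intro F B hB h0 hF x y hx hy a b
    have h1 : ∀ j, ∑ k, F j k * (a • x + b • y) j k
        = a * ∑ k, F j k * x j k + b * ∑ k, F j k * y j k := by
      intro j
      simp only [Pi.add_apply, Pi.smul_apply, smul_eq_mul, Finset.mul_sum,
        ← Finset.sum_add_distrib]
      exact Finset.sum_congr rfl fun k _ => by ring
    simp only [h1]
    rw [integral_add ((hx.integrable hB h0 hF P).const_mul a)
      ((hy.integrable hB h0 hF P).const_mul b), integral_const_mul, integral_const_mul]
    simp only [smul_eq_mul]
    ring
  obtain ⟨α, β, hα, hβ, hβ1, hd⟩ := exists_lagrange_multipliers (c := c) (W := W)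
    (G := fun i x => m * ∫ j, ∑ k, (req j).use i k * x j k ∂P)
    (H := fun i x => m * ∫ j, ∑ k, (req j).profit i k * x j k ∂P)
    (IsFractionalAssignment.convex (J := J) (K := K))
    (fun i => ⟨IsFractionalAssignment.convex, fun x hx y hy a b _ _ _ =>
      (hlin (hb.A_nonneg i) (fun j => hb.use_nonneg j i) (fun j => hb.use_le j i) hx hy a b).le⟩)
    (fun i => ⟨IsFractionalAssignment.convex, fun x hx y hy a b _ _ _ =>
      (hlin hb.w_nonneg (fun j => hb.profit_nonneg j i) (fun j => hb.profit_le j i) hx hy a b).ge⟩)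
    IsFractionalAssignment.zero (fun i => by simpa using hc i)
    (fun x hx hxc => by
      by_contra! h
      have hne : (Finset.univ : Finset (Fin n)).Nonempty := ⟨⟨0, hn⟩, Finset.mem_univ _⟩
      set v := Finset.univ.inf' hne
        fun i => (m : ℝ) * ∫ j, ∑ k, (req j).profit i k * x j k ∂P with hv
      have h1 : v ≤ W := hopt x v hx hxc fun i => Finset.inf'_le _ (Finset.mem_univ i)
      have h2 : W < v := (Finset.lt_inf'_iff _).2 fun i _ => h i
      exact absurd h1 h2.not_ge)
  -- The Lagrangian splits over requests. Its maximum over the options of j is the gain ρ j,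
  -- nonnegative because the null option counts.
  set g : J → Option K → ℝ := fun j o =>
    ∑ i, β i * (req j).profitOf i o - ∑ i, α i * (req j).useOf i o with hg
  have hmax : ∀ j, ∃ o, ∀ o', g j o' ≤ g j o := fun j => Finite.exists_max (g j)
  choose s hs using hmax
  have hnone : ∀ j, g j none = 0 := by
    intro j; simp [hg, Request.profitOf, Request.useOf]
  set x : J → K → ℝ := fun j k => if s j = some k then 1 else 0 with hx
  have hsel : ∀ (j : J) (F : K → ℝ), ∑ k, F k * x j k = (s j).elim 0 F := by
    intro j F
    simp only [hx]
    cases s j with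
    | none => simp
    | some k => simp
  have hxf : IsFractionalAssignment x := by
    refine ⟨fun j k => by simp only [hx]; split_ifs <;> norm_num, fun j => ?_⟩
    have := hsel j fun _ => 1
    simp only [one_mul] at this
    rw [this]
    cases s j <;> simp
  refine ⟨α, β, fun j => g j (s j), hα, hβ, hβ1, fun j => (hnone j).symm.trans_le (hs j none),
    fun j => ?_, fun j k => hs j (some k), ?_⟩
  · have h1 : 0 ≤ ∑ i, α i * (req j).useOf i (s j) := Finset.sum_nonneg fun i _ =>
      mul_nonneg (hα i) (by
        cases s j with
        | none => exact le_rfl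
        | some k => exact hb.use_nonneg j i k)
    -- The normalization ∑ β = 1 keeps the gains below w; their concentration depends on this.
    have h2 : ∑ i, β i * (req j).profitOf i (s j) ≤ ∑ i, β i * w := Finset.sum_le_sum fun i _ =>
      mul_le_mul_of_nonneg_left (by
        cases s j with
        | none => exact hb.w_nonneg
        | some k => exact hb.profit_le j i k) (hβ i)
    rw [← Finset.sum_mul, hβ1, one_mul] at h2
    simp only [hg]
    linarith
  -- The pointwise maximizer is itself an admissible assignment, and the multiplier inequality for
  -- it is the bound on the dual objective.
  · refine le_trans (le_of_eq ?_) (hd x hxf)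
    have hiu : ∀ i, Integrable (fun j => ∑ k, (req j).use i k * x j k) P := fun i =>
      hxf.integrable (hb.A_nonneg i) (fun j => hb.use_nonneg j i) (fun j => hb.use_le j i) P
    have hip : ∀ i, Integrable (fun j => ∑ k, (req j).profit i k * x j k) P := fun i =>
      hxf.integrable hb.w_nonneg (fun j => hb.profit_nonneg j i) (fun j => hb.profit_le j i) P
    have hge : ∀ j, g j (s j) = ∑ i, β i * ∑ k, (req j).profit i k * x j k
        - ∑ i, α i * ∑ k, (req j).use i k * x j k := by
      intro j
      simp only [hsel]
      rfl
    simp only [hge]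
    rw [integral_sub (integrable_finsetSum _ fun i _ => (hip i).const_mul _)
      (integrable_finsetSum _ fun i _ => (hiu i).const_mul _),
      integral_finsetSum _ fun i _ => (hip i).const_mul _,
      integral_finsetSum _ fun i _ => (hiu i).const_mul _, mul_sub, Finset.mul_sum, Finset.mul_sum]
    simp only [integral_const_mul]
    congr 1 <;> exact Finset.sum_congr rfl fun i _ => by ring

end LP

/-! ### Totals of an online policy -/

section Run

variable {Q K : Type*}

/-- The total of `g` over the requests `q`, which arrive after the requests `pre` and are served
by the policy `D`. -/
def run (D : List Q → Q → Option K) (g : Q → Option K → ℝ) : List Q → List Q → ℝ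
  | _, [] => 0
  | pre, a :: q => g a (D pre a) + run D g (pre ++ [a]) q

theorem run_append (D : List Q → Q → Option K) (g : Q → Option K → ℝ) (pre q q' : List Q) :
    run D g pre (q ++ q') = run D g pre q + run D g (pre ++ q) q' := by
  induction q generalizing pre with
  | nil => simp [run]
  | cons a q ih => simp [run, ih, add_assoc]

theorem run_singleton (D : List Q → Q → Option K) (g : Q → Option K → ℝ) (pre : List Q) (a : Q) :
    run D g pre [a] = g a (D pre a) := by
  simp [run]

theorem run_congr {D D' : List Q → Q → Option K} (g : Q → Option K → ℝ) {pre pre' q : List Q}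
    (h : ∀ q₁ a, q₁.length < q.length → D (pre ++ q₁) a = D' (pre' ++ q₁) a) :
    run D g pre q = run D' g pre' q := by
  induction q generalizing pre pre' with
  | nil => rfl
  | cons b q ih =>
    have h0 := h [] b (by simp)
    simp only [List.append_nil] at h0
    simp only [run, h0]
    congr 1
    refine ih fun q₁ a hq => ?_
    have := h (b :: q₁) a (by simpa using hq)
    simpa using this

theorem run_eq_zero {D : List Q → Q → Option K} {g : Q → Option K → ℝ} {pre q : List Q}
    (hg : ∀ a, g a none = 0) (h : ∀ q₁ a, q₁.length < q.length → D (pre ++ q₁) a = none) :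
    run D g pre q = 0 := by
  induction q generalizing pre with
  | nil => rfl
  | cons b q ih =>
    have h0 := h [] b (by simp)
    simp only [List.append_nil] at h0
    simp only [run, h0, hg, zero_add]
    refine ih fun q₁ a hq => ?_
    have := h (b :: q₁) a (by simpa using hq)
    simpa using this

theorem sum_eq_run (D : List Q → Q → Option K) (g : Q → Option K → ℝ) {m : ℕ} (pre : List Q)
    (R : Fin m → Q) :
    ∑ t : Fin m, g (R t) (D (pre ++ (List.ofFn R).take t) (R t)) = run D g pre (List.ofFn R) := by
  induction m generalizing pre with
  | zero => simp [run]
  | succ m ih =>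
    rw [Fin.sum_univ_succ, List.ofFn_succ]
    simp only [run, ← ih (pre ++ [R 0])]
    simp

end Run

/-! ### Splitting the algorithm into stages -/

namespace Input

variable {n : ℕ} (I : Input n) {K : Type*}

/-- The policy of the algorithm within a stage of length `t` with estimate `Z`, given the earlier
requests of this stage. -/
noncomputable def stagePolicy (sel : (Option K → ℝ) → Option K) (t : ℕ) (Z : ℝ) (past : List (Request n K))
    (cur : Request n K) : Option K :=
  sel (score (I.stageWeights sel t Z past) cur)

theorem stageWeights_append (sel : (Option K → ℝ) → Option K) (t : ℕ) (Z : ℝ)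
    (q : List (Request n K)) (a : Request n K) :
    I.stageWeights sel t Z (q ++ [a]) =
      I.updateWeights t Z (I.stageWeights sel t Z q) a (I.stagePolicy sel t Z q a) := by
  simp [stageWeights, stagePolicy]

/-- The product of the updates telescopes: the weights depend on the past only through its length
and the consumption so far. -/
theorem stageWeights_x (sel : (Option K → ℝ) → Option K) {t : ℕ} {Z : ℝ} (h : 0 < 1 + I.epsX t)
    (q : List (Request n K)) (i : Fin n) :
    (I.stageWeights sel t Z q).x i = (I.initWeights t Z).x i *
      ((1 + I.epsX t) ^ (run (I.stagePolicy sel t Z) (fun a => a.useOf i) [] q / (I.γ * I.c i))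
        / (1 + I.epsX t / (I.m * I.γ)) ^ q.length) := by
  induction q using List.reverseRecOn with
  | nil => simp [stageWeights, run]
  | append_singleton q a ih =>
    rw [stageWeights_append, run_append, List.nil_append, run_singleton, add_div, Real.rpow_add h]
    simp only [updateWeights, ih, List.length_append, List.length_singleton, pow_succ]
    rw [mul_assoc, div_mul_div_comm]

theorem stageWeights_y (sel : (Option K → ℝ) → Option K) {t : ℕ} {Z : ℝ} (h : 0 < 1 - I.epsY t Z)
    (q : List (Request n K)) (i : Fin n) :
    (I.stageWeights sel t Z q).y i = (I.initWeights t Z).y i *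
      ((1 - I.epsY t Z) ^ (run (I.stagePolicy sel t Z) (fun a => a.profitOf i) [] q / I.wmax)
        / (1 - I.epsY t Z * Z / (I.m * I.wmax)) ^ q.length) := by
  induction q using List.reverseRecOn with
  | nil => simp [stageWeights, run]
  | append_singleton q a ih =>
    rw [stageWeights_append, run_append, List.nil_append, run_singleton, add_div, Real.rpow_add h]
    simp only [updateWeights, ih, List.length_append, List.length_singleton, pow_succ]
    rw [mul_assoc, div_mul_div_comm]

theorem prevStart_add_prevLen (r : ℕ) : I.prevStart r + I.prevLen r = I.len r := by
  unfold prevStart prevLen len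
  cases r with
  | zero => simp
  | succ r => simp [pow_succ]; ring

theorem len_succ (r : ℕ) : I.len (r + 1) = I.len r + I.len r := by
  simp [len, pow_succ]; ring

variable [Fintype K]

theorem estimate_append {r : ℕ} {pre : List (Request n K)} (h : pre.length = I.len r)
    (q : List (Request n K)) : I.estimate r (pre ++ q) = I.estimate r pre := by
  have hl := I.prevStart_add_prevLen r
  have : ((pre ++ q).drop (I.prevStart r)).take (I.prevLen r)
      = (pre.drop (I.prevStart r)).take (I.prevLen r) := by
    rw [List.drop_append_of_le_length (by omega), List.take_append_of_le_length (by simp; omega)]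
  simp only [estimate, this]

theorem decision_append (sel : (Option K → ℝ) → Option K) {r : ℕ} {pre q : List (Request n K)}
    (h : pre.length = I.len r) (hq : q.length < I.len r) (a : Request n K) :
    I.decision sel (pre ++ q) a = I.stagePolicy sel (I.len r) (I.estimate r pre) q a := by
  have hu : 0 < I.firstLen := by
    by_contra! h0
    simp [len, Nat.le_zero.1 h0] at hq
  have hle : I.firstLen ≤ I.len r := Nat.le_mul_of_pos_right _ (by positivity)
  have hlog : Nat.log 2 ((pre ++ q).length / I.firstLen) = r := by
    -- The number of past requests lies in [t_r, 2 t_r), that is, between `firstLen` times 2^r and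
    -- 2^(r+1).
    rw [Nat.log_eq_iff (Or.inr ⟨by norm_num, ?_⟩)]
    · rw [List.length_append, Nat.le_div_iff_mul_le hu, Nat.div_lt_iff_lt_mul hu]
      have := I.len_succ r
      unfold len at *
      constructor
      · rw [mul_comm]; omega
      · rw [mul_comm]; omega
    · rw [List.length_append]
      exact (Nat.div_pos (by omega) hu).ne'
  unfold decision
  rw [if_neg (by rw [List.length_append]; omega)]
  simp only [hlog, I.estimate_append h, stagePolicy]
  rw [← h, List.drop_left]

/-- The totals of the algorithm are the sums of its totals in the stages. -/
theorem run_decision (sel : (Option K → ℝ) → Option K) {g : Request n K → Option K → ℝ}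
    (hg : ∀ a, g a none = 0) {l : ℕ} {q : List (Request n K)} (hq : q.length = I.len l) :
    run (I.decision sel) g [] q = ∑ r ∈ Finset.range l,
      run (I.stagePolicy sel (I.len r) (I.estimate r (q.take (I.len r)))) g []
        ((q.drop (I.len r)).take (I.len r)) := by
  induction l generalizing q with
  | zero =>
    rw [Finset.sum_range_zero]
    -- Since t_0 = `firstLen`, the base case is stage -1, where nothing is served.
    refine run_eq_zero hg fun q₁ a h => ?_
    unfold decision
    rw [if_pos]
    simpa [len] using h.trans_eq hq
  | succ l ih =>
    have h2 := I.len_succ l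
    rw [Finset.sum_range_succ]
    conv_lhs => rw [← List.take_append_drop (I.len l) q]
    have hlen : (q.take (I.len l)).length = I.len l := by simp; omega
    have hlen' : (q.drop (I.len l)).length = I.len l := by simp; omega
    rw [run_append, ih hlen]
    congr 1
    · refine Finset.sum_congr rfl fun r hr => ?_
      have hr' : r < l := Finset.mem_range.1 hr
      have hmono : I.len r + I.len r ≤ I.len l := by
        rw [← len_succ]
        exact Nat.mul_le_mul_left _ (Nat.pow_le_pow_right (by norm_num) hr')
      rw [List.take_take, min_eq_left (by omega), List.drop_take, List.take_take,
        min_eq_left (by omega)]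
    · rw [List.nil_append, List.take_of_length_le hlen'.le]
      refine run_congr g fun q₁ a h => ?_
      rw [List.nil_append]
      exact I.decision_append sel hlen (h.trans_eq hlen') a

end Input

theorem Bounded.useOf_mem {n : ℕ} {J K : Type*} {req : J → Request n K} {A : Fin n → ℝ} {w : ℝ}
    (hb : Bounded req A w) (j : J) (i : Fin n) (o : Option K) :
    0 ≤ (req j).useOf i o ∧ (req j).useOf i o ≤ A i := by
  cases o with
  | none => exact ⟨le_rfl, hb.A_nonneg i⟩
  | some k => exact ⟨hb.use_nonneg j i k, hb.use_le j i k⟩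

theorem Bounded.profitOf_mem {n : ℕ} {J K : Type*} {req : J → Request n K} {A : Fin n → ℝ} {w : ℝ}
    (hb : Bounded req A w) (j : J) (i : Fin n) (o : Option K) :
    0 ≤ (req j).profitOf i o ∧ (req j).profitOf i o ≤ w := by
  cases o with
  | none => exact ⟨le_rfl, hb.w_nonneg⟩
  | some k => exact ⟨hb.profit_nonneg j i k, hb.profit_le j i k⟩

/-! ### The potential of a stage -/

namespace Input

variable {n : ℕ} (I : Input n)

/-- The conditions on the parameters of a stage of length `t` with estimate `Z` under which the
weights are positive. -/
structure StageParams (t : ℕ) (Z : ℝ) : Prop where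
  c_pos : ∀ i, 0 < I.c i
  m_pos : 0 < (I.m : ℝ)
  γ_pos : 0 < I.γ
  wmax_pos : 0 < I.wmax
  Z_pos : 0 < Z
  Z_le : Z ≤ I.m * I.wmax
  t_pos : 0 < t
  x_pos : 0 < I.epsX t
  y_pos : 0 < I.epsY t Z
  y_lt : I.epsY t Z < 1

/-- The pessimistic estimator of the failure probability, as a function of the weights. -/
noncomputable def potential (t : ℕ) (Z : ℝ) (φ : Weights n) : ℝ :=
  ∑ i, φ.x i * (I.γ * I.c i * (1 + I.epsX t / (I.m * I.γ)) / I.epsX t) +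
    ∑ i, φ.y i * (I.wmax * (1 - I.epsY t Z * Z / (I.m * I.wmax)) / I.epsY t Z)

variable {I} {t : ℕ} {Z : ℝ}

theorem StageParams.A_pos (h : I.StageParams t Z) : 0 < 1 + I.epsX t / (I.m * I.γ) := by
  have := h.m_pos
  have := h.γ_pos
  have := h.x_pos
  positivity

theorem StageParams.B_pos (h : I.StageParams t Z) :
    0 < 1 - I.epsY t Z * Z / (I.m * I.wmax) := by
  have hmw := mul_pos h.m_pos h.wmax_pos
  rw [sub_pos, div_lt_one hmw]
  nlinarith [h.Z_le, h.y_lt, h.y_pos, h.Z_pos]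

theorem StageParams.initWeights_nonneg (h : I.StageParams t Z) (i : Fin n) :
    0 ≤ (I.initWeights t Z).x i ∧ 0 ≤ (I.initWeights t Z).y i := by
  have := h.A_pos
  have := h.B_pos
  have := h.x_pos
  have := h.y_pos
  have := h.γ_pos
  have := h.wmax_pos
  have := h.c_pos i
  have : 0 < 1 - I.epsY t Z := sub_pos.2 h.y_lt
  constructor <;> simp only [initWeights] <;> positivity

variable {K : Type*}

theorem StageParams.stageWeights_nonneg (h : I.StageParams t Z) (sel : (Option K → ℝ) → Option K)
    (q : List (Request n K)) (i : Fin n) :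
    0 ≤ (I.stageWeights sel t Z q).x i ∧ 0 ≤ (I.stageWeights sel t Z q).y i := by
  have := h.A_pos
  have := h.B_pos
  have := h.initWeights_nonneg i
  have h1 : 0 < 1 - I.epsY t Z := sub_pos.2 h.y_lt
  have h2 : 0 < 1 + I.epsX t := by linarith [h.x_pos]
  rw [I.stageWeights_x sel h2, I.stageWeights_y sel h1]
  constructor
  · exact mul_nonneg this.1 (by positivity)
  · exact mul_nonneg this.2 (by positivity)

theorem StageParams.potential_nonneg (h : I.StageParams t Z) {φ : Weights n}
    (hx : ∀ i, 0 ≤ φ.x i) (hy : ∀ i, 0 ≤ φ.y i) : 0 ≤ I.potential t Z φ := by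
  have := h.A_pos
  have := h.B_pos
  have := h.x_pos
  have := h.y_pos
  have := h.γ_pos
  have := h.wmax_pos
  have := h.c_pos
  exact add_nonneg (Finset.sum_nonneg fun i _ => mul_nonneg (hx i) (by have := h.c_pos i; positivity))
    (Finset.sum_nonneg fun i _ => mul_nonneg (hy i) (by positivity))

/-- Bernoulli's inequality linearizes both powers in the chosen option; the normalizing factors of
`potential` are such that the linear part is exactly `score`. -/
theorem StageParams.potential_update_le (h : I.StageParams t Z) {φ : Weights n}
    (hx : ∀ i, 0 ≤ φ.x i) (hy : ∀ i, 0 ≤ φ.y i) {a : Request n K} {o : Option K}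
    (hu : ∀ i, 0 ≤ a.useOf i o ∧ a.useOf i o ≤ I.γ * I.c i)
    (hp : ∀ i, 0 ≤ a.profitOf i o ∧ a.profitOf i o ≤ I.wmax) :
    I.potential t Z (I.updateWeights t Z φ a o) ≤
      (∑ i, φ.x i * (I.γ * I.c i / I.epsX t) + ∑ i, φ.y i * (I.wmax / I.epsY t Z))
        + score φ a o := by
  have hA := h.A_pos
  have hB := h.B_pos
  have hX := h.x_pos
  have hY := h.y_pos
  have hγ := h.γ_pos
  have hw := h.wmax_pos
  have e1 : ∀ i, (I.updateWeights t Z φ a o).x i *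
      (I.γ * I.c i * (1 + I.epsX t / (I.m * I.γ)) / I.epsX t) ≤
      φ.x i * (I.γ * I.c i / I.epsX t) + a.useOf i o * φ.x i := by
    intro i
    have hc := h.c_pos i
    have hb : (1 + I.epsX t) ^ (a.useOf i o / (I.γ * I.c i))
        ≤ 1 + a.useOf i o / (I.γ * I.c i) * I.epsX t :=
      rpow_one_add_le_one_add_mul_self (by linarith) (div_nonneg (hu i).1 (by positivity))
        ((div_le_one (by positivity)).2 (hu i).2)
    calc _ = φ.x i * (I.γ * I.c i / I.epsX t) * (1 + I.epsX t) ^ (a.useOf i o / (I.γ * I.c i)) := by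
          simp only [updateWeights]
          generalize (1 + I.epsX t) ^ (a.useOf i o / (I.γ * I.c i)) = y
          generalize 1 + I.epsX t / (I.m * I.γ) = A at hA
          field_simp
      _ ≤ φ.x i * (I.γ * I.c i / I.epsX t) * (1 + a.useOf i o / (I.γ * I.c i) * I.epsX t) :=
          mul_le_mul_of_nonneg_left hb (mul_nonneg (hx i) (by positivity))
      _ = _ := by field_simp
  have e2 : ∀ i, (I.updateWeights t Z φ a o).y i *
      (I.wmax * (1 - I.epsY t Z * Z / (I.m * I.wmax)) / I.epsY t Z) ≤
      φ.y i * (I.wmax / I.epsY t Z) - a.profitOf i o * φ.y i := by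
    intro i
    have hb : (1 + -I.epsY t Z) ^ (a.profitOf i o / I.wmax)
        ≤ 1 + a.profitOf i o / I.wmax * (-I.epsY t Z) :=
      rpow_one_add_le_one_add_mul_self (by linarith [h.y_lt]) (div_nonneg (hp i).1 hw.le)
        ((div_le_one hw).2 (hp i).2)
    calc _ = φ.y i * (I.wmax / I.epsY t Z) * (1 + -I.epsY t Z) ^ (a.profitOf i o / I.wmax) := by
          simp only [updateWeights, ← sub_eq_add_neg]
          generalize (1 - I.epsY t Z) ^ (a.profitOf i o / I.wmax) = y
          generalize 1 - I.epsY t Z * Z / (I.m * I.wmax) = B at hB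
          field_simp
      _ ≤ φ.y i * (I.wmax / I.epsY t Z) * (1 + a.profitOf i o / I.wmax * (-I.epsY t Z)) :=
          mul_le_mul_of_nonneg_left hb (mul_nonneg (hy i) (by positivity))
      _ = _ := by field_simp; ring
  have s1 := Finset.sum_le_sum fun i (_ : i ∈ Finset.univ) => e1 i
  have s2 := Finset.sum_le_sum fun i (_ : i ∈ Finset.univ) => e2 i
  rw [Finset.sum_add_distrib] at s1
  rw [Finset.sum_sub_distrib] at s2
  unfold potential score
  linarith

/-- The factor in `potential` completes the power t - 1 of the initial weights to t, and the t
updates cancel it. What remains is one Chernoff exponential per constraint. -/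
theorem StageParams.potential_stageWeights (h : I.StageParams t Z)
    (sel : (Option K → ℝ) → Option K) {q : List (Request n K)} (hq : q.length = t) :
    I.potential t Z (I.stageWeights sel t Z q) =
      ∑ i, (1 + I.epsX t) ^ (run (I.stagePolicy sel t Z) (fun a => a.useOf i) [] q / (I.γ * I.c i)
          - (1 + I.epsX t) * (t / (I.m * I.γ))) +
      ∑ i, (1 - I.epsY t Z) ^ (run (I.stagePolicy sel t Z) (fun a => a.profitOf i) [] q / I.wmax
          - (1 - I.epsY t Z) * (t * Z / (I.m * I.wmax))) := by
  have hA := h.A_pos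
  have hB := h.B_pos
  have hX := h.x_pos
  have hY := h.y_pos
  have hγ := h.γ_pos
  have hw := h.wmax_pos
  have hm := h.m_pos
  have h1Y : 0 < 1 - I.epsY t Z := sub_pos.2 h.y_lt
  have h1X : 0 < 1 + I.epsX t := by linarith
  -- Writing t = s + 1 removes the truncated subtraction in t - 1.
  obtain ⟨s, rfl⟩ := Nat.exists_eq_add_of_lt h.t_pos
  rw [zero_add] at *
  unfold potential
  congr 1 <;> refine Finset.sum_congr rfl fun i _ => ?_
  · have hc := h.c_pos i
    rw [I.stageWeights_x sel h1X, Real.rpow_sub h1X, hq]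
    simp only [initWeights, Nat.add_sub_cancel, pow_succ]
    have h1 := Real.rpow_pos_of_pos h1X
      ((1 + I.epsX (s + 1)) * (((s + 1 : ℕ) : ℝ) / (I.m * I.γ)))
    generalize (1 + I.epsX (s + 1)) ^ ((1 + I.epsX (s + 1)) * (((s + 1 : ℕ) : ℝ) / (I.m * I.γ)))
      = y at h1 ⊢
    generalize (1 + I.epsX (s + 1)) ^ (_ / (I.γ * I.c i)) = z
    generalize 1 + I.epsX (s + 1) / (I.m * I.γ) = A at hA
    field_simp
  · rw [I.stageWeights_y sel h1Y, Real.rpow_sub h1Y, hq]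
    simp only [initWeights, Nat.add_sub_cancel, pow_succ]
    have h1 := Real.rpow_pos_of_pos h1Y
      ((1 - I.epsY (s + 1) Z) * (((s + 1 : ℕ) : ℝ) * Z / (I.m * I.wmax)))
    generalize (1 - I.epsY (s + 1) Z) ^
      ((1 - I.epsY (s + 1) Z) * (((s + 1 : ℕ) : ℝ) * Z / (I.m * I.wmax))) = y at h1 ⊢
    generalize (1 - I.epsY (s + 1) Z) ^ (_ / I.wmax) = z
    generalize 1 - I.epsY (s + 1) Z * Z / (I.m * I.wmax) = A at hB
    field_simp

/-- At the start the potential is the plain Chernoff bound for the oblivious policy, with mean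
1/(mγ) for consumption and Z/(m w_max) for profit in normalized units. -/
theorem StageParams.potential_initWeights_le (h : I.StageParams t Z) :
    I.potential t Z (I.initWeights t Z : Weights n) ≤
      n * Real.exp (-(I.epsX t ^ 2 / (2 + I.epsX t) * (t * (1 / (I.m * I.γ))))) +
      n * Real.exp (-(I.epsY t Z ^ 2 / 2 * (t * (Z / (I.m * I.wmax))))) := by
  have hA := h.A_pos
  have hB := h.B_pos
  have hX := h.x_pos
  have hY := h.y_pos
  have hγ := h.γ_pos
  have hw := h.wmax_pos
  have hm := h.m_pos
  have hZ := h.Z_pos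
  have b1 := upper_tail_bound (ε := I.epsX t) (μ' := 1 / (I.m * I.γ)) hX (by positivity) le_rfl t
  have b2 := lower_tail_bound (ε := I.epsY t Z) (μ := Z / (I.m * I.wmax)) hY h.y_lt
    (by positivity) (by rw [← mul_div_assoc]; linarith) t
  have e1 : ∀ i, (I.initWeights t Z : Weights n).x i *
      (I.γ * I.c i * (1 + I.epsX t / (I.m * I.γ)) / I.epsX t)
      ≤ Real.exp (-(I.epsX t ^ 2 / (2 + I.epsX t) * (t * (1 / (I.m * I.γ))))) := by
    intro i
    refine le_trans (le_of_eq ?_) b1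
    have hc := h.c_pos i
    have e : (t : ℝ) * (1 / (I.m * I.γ)) + I.epsX t * (t * (1 / (I.m * I.γ)))
        = (1 + I.epsX t) * (t / (I.m * I.γ)) := by ring
    rw [e, mul_one_div, ← mul_pow_sub_one h.t_pos.ne' (1 + I.epsX t / (I.m * I.γ))]
    simp only [initWeights]
    generalize 1 + I.epsX t / (I.m * I.γ) = A at hA
    field_simp
  have e2 : ∀ i, (I.initWeights t Z : Weights n).y i *
      (I.wmax * (1 - I.epsY t Z * Z / (I.m * I.wmax)) / I.epsY t Z)
      ≤ Real.exp (-(I.epsY t Z ^ 2 / 2 * (t * (Z / (I.m * I.wmax))))) := by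
    intro i
    refine le_trans (le_of_eq ?_) b2
    rw [← mul_div_assoc, ← mul_div_assoc,
      ← mul_pow_sub_one h.t_pos.ne' (1 - I.epsY t Z * Z / (I.m * I.wmax))]
    simp only [initWeights]
    generalize 1 - I.epsY t Z * Z / (I.m * I.wmax) = A at hB
    field_simp
  have s1 := Finset.sum_le_sum fun i (_ : i ∈ Finset.univ) => e1 i
  have s2 := Finset.sum_le_sum fun i (_ : i ∈ Finset.univ) => e2 i
  simp only [Finset.sum_const, Finset.card_univ, Fintype.card_fin, nsmul_eq_mul] at s1 s2
  exact add_le_add s1 s2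

/-- The requests of a stage on which the algorithm, run with estimate `Z`, exceeds the scaled
capacities or misses the scaled estimate. -/
def stageFailure (I : Input n) (sel : (Option K → ℝ) → Option K) (t : ℕ) (Z : ℝ) :
    Set (List (Request n K)) :=
  {q | ¬ ((∀ i, run (I.stagePolicy sel t Z) (fun a => a.useOf i) [] q
        ≤ (1 + I.epsX t) * (t * I.c i / I.m)) ∧
      ∀ i, (1 - I.epsY t Z) * (t * Z / I.m)
        ≤ run (I.stagePolicy sel t Z) (fun a => a.profitOf i) [] q)}

theorem StageParams.one_le_potential (h : I.StageParams t Z)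
    (sel : (Option K → ℝ) → Option K) {q : List (Request n K)} (hq : q.length = t)
    (hf : q ∈ I.stageFailure sel t Z) : 1 ≤ I.potential t Z (I.stageWeights sel t Z q) := by
  have hX := h.x_pos
  have hY := h.y_pos
  have hγ := h.γ_pos
  have hw := h.wmax_pos
  have hm := h.m_pos
  have h1Y : 0 < 1 - I.epsY t Z := sub_pos.2 h.y_lt
  have h1X : 0 < 1 + I.epsX t := by linarith
  rw [h.potential_stageWeights sel hq]
  have n1 := fun (i : Fin n) => (Real.rpow_pos_of_pos h1X
    (run (I.stagePolicy sel t Z) (fun a => a.useOf i) [] q / (I.γ * I.c i)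
          - (1 + I.epsX t) * (t / (I.m * I.γ)))).le
  have n2 := fun (i : Fin n) => (Real.rpow_pos_of_pos h1Y
    (run (I.stagePolicy sel t Z) (fun a => a.profitOf i) [] q / I.wmax
          - (1 - I.epsY t Z) * (t * Z / (I.m * I.wmax)))).le
  rw [stageFailure, Set.mem_ofPred_eq, not_and_or] at hf
  rcases hf with hf | hf <;> push Not at hf <;> obtain ⟨i, hi⟩ := hf
  · refine le_add_of_le_of_nonneg (le_trans ?_ (Finset.single_le_sum (fun i _ => n1 i)
      (Finset.mem_univ i))) (Finset.sum_nonneg fun i _ => n2 i)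
    refine Real.one_le_rpow (by linarith) (sub_nonneg.2 ?_)
    have hc := h.c_pos i
    rw [le_div_iff₀ (by positivity)]
    refine le_trans (le_of_eq ?_) hi.le
    field_simp
  · refine le_add_of_nonneg_of_le (Finset.sum_nonneg fun i _ => n1 i)
      (le_trans ?_ (Finset.single_le_sum (fun i _ => n2 i) (Finset.mem_univ i)))
    refine Real.one_le_rpow_of_pos_of_le_one_of_nonpos h1Y (by linarith) (sub_nonpos.2 ?_)
    rw [div_le_iff₀ hw]
    refine hi.le.trans (le_of_eq ?_)
    field_simp

/-- The minimal score is at most the score of every fractional choice. -/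
theorem score_le_of_isFractionalAssignment [Fintype K] {J : Type*} {req : J → Request n K}
    {x : J → K → ℝ} (hx : IsFractionalAssignment x) {φ : Weights n} {j : J} {o : Option K}
    (ho : ∀ o', score φ (req j) o ≤ score φ (req j) o') :
    score φ (req j) o ≤ ∑ i, φ.x i * ∑ k, (req j).use i k * x j k
      - ∑ i, φ.y i * ∑ k, (req j).profit i k * x j k := by
  have h0 : score φ (req j) o ≤ 0 := by
    simpa [score, Request.useOf, Request.profitOf] using ho none
  have h1 : ∑ k, x j k * score φ (req j) o ≤ ∑ k, x j k * score φ (req j) (some k) :=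
    Finset.sum_le_sum fun k _ => mul_le_mul_of_nonneg_left (ho _) (hx.1 j k)
  rw [← Finset.sum_mul] at h1
  have h2 : ∑ k, x j k * score φ (req j) (some k) = ∑ i, φ.x i * ∑ k, (req j).use i k * x j k
      - ∑ i, φ.y i * ∑ k, (req j).profit i k * x j k := by
    simp only [score, mul_sub, Finset.mul_sum, Finset.sum_sub_distrib, Request.useOf,
      Request.profitOf, Option.elim_some]
    rw [Finset.sum_comm, Finset.sum_comm (s := Finset.univ (α := K))]
    congr 1 <;>
    exact Finset.sum_congr rfl fun i _ => Finset.sum_congr rfl fun k _ => by ring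
  rw [← h2]
  -- The mass that x leaves unused goes to the null option: the minimal score is at most 0, so it is
  -- at most its multiple by ∑ x ≤ 1.
  nlinarith [hx.2 j]

variable [Fintype K] {J : Type*} [Countable J] [MeasurableSpace J] [DiscreteMeasurableSpace J]

/-- The option chosen is compared with x: its expected score is at most ∑ φ_x c/m - ∑ φ_y Z/m,
exactly what the `potential` of the present weights contains beyond the constant b. -/
theorem StageParams.lintegral_potential_update_le (h : I.StageParams t Z)
    {sel : (Option K → ℝ) → Option K} (hsel : ∀ (f : Option K → ℝ) (o : Option K), f (sel f) ≤ f o)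
    {req : J → Request n K} (hb : Bounded req (fun i => I.γ * I.c i) I.wmax)
    (P : Measure J) [IsProbabilityMeasure P] {x : J → K → ℝ} (hx : IsFractionalAssignment x)
    (hxu : ∀ i, I.m * ∫ j, ∑ k, (req j).use i k * x j k ∂P ≤ I.c i)
    (hxp : ∀ i, Z ≤ I.m * ∫ j, ∑ k, (req j).profit i k * x j k ∂P)
    {φ : Weights n} (hφx : ∀ i, 0 ≤ φ.x i) (hφy : ∀ i, 0 ≤ φ.y i) :
    ∫⁻ j, ENNReal.ofReal
      (I.potential t Z (I.updateWeights t Z φ (req j) (sel (score φ (req j))))) ∂P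
      ≤ ENNReal.ofReal (I.potential t Z φ) := by
  have hA := h.A_pos
  have hB := h.B_pos
  have hX := h.x_pos
  have hY := h.y_pos
  have hγ := h.γ_pos
  have hw := h.wmax_pos
  have hm := h.m_pos
  have h1Y : 0 < 1 - I.epsY t Z := sub_pos.2 h.y_lt
  set b := ∑ i, φ.x i * (I.γ * I.c i / I.epsX t) + ∑ i, φ.y i * (I.wmax / I.epsY t Z) with hbdef
  set f : J → ℝ := fun j => b + (∑ i, φ.x i * ∑ k, (req j).use i k * x j k
      - ∑ i, φ.y i * ∑ k, (req j).profit i k * x j k) with hf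
  have hle : ∀ j, I.potential t Z (I.updateWeights t Z φ (req j) (sel (score φ (req j)))) ≤ f j :=
    fun j => (h.potential_update_le hφx hφy (fun i => hb.useOf_mem j i _)
      (fun i => hb.profitOf_mem j i _)).trans
      (by
        have := score_le_of_isFractionalAssignment hx (hsel (score φ (req j)))
        simp only [hf]
        linarith)
  have hnn : ∀ j, 0 ≤ I.potential t Z (I.updateWeights t Z φ (req j) (sel (score φ (req j)))) :=
    fun j => h.potential_nonneg
      (fun i => mul_nonneg (hφx i) (by positivity))
      (fun i => mul_nonneg (hφy i) (by positivity))
  have hiu : ∀ i, Integrable (fun j => ∑ k, (req j).use i k * x j k) P := fun i =>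
    hx.integrable (hb.A_nonneg i) (fun j => hb.use_nonneg j i) (fun j => hb.use_le j i) P
  have hip : ∀ i, Integrable (fun j => ∑ k, (req j).profit i k * x j k) P := fun i =>
    hx.integrable hb.w_nonneg (fun j => hb.profit_nonneg j i) (fun j => hb.profit_le j i) P
  have hi1 := integrable_finsetSum Finset.univ fun i _ => (hiu i).const_mul (φ.x i)
  have hi2 := integrable_finsetSum Finset.univ fun i _ => (hip i).const_mul (φ.y i)
  have hi3 : Integrable (fun j => ∑ i, φ.x i * ∑ k, (req j).use i k * x j k
      - ∑ i, φ.y i * ∑ k, (req j).profit i k * x j k) P := hi1.sub hi2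
  have hfi : Integrable f P := (integrable_const b).add hi3
  refine (lintegral_mono fun j => ENNReal.ofReal_le_ofReal (hle j)).trans ?_
  rw [← ofReal_integral_eq_lintegral_ofReal hfi (.of_forall fun j => (hnn j).trans (hle j))]
  refine ENNReal.ofReal_le_ofReal ?_
  have hint : ∫ j, f j ∂P = b + (∑ i, φ.x i * ∫ j, ∑ k, (req j).use i k * x j k ∂P
      - ∑ i, φ.y i * ∫ j, ∑ k, (req j).profit i k * x j k ∂P) := by
    simp only [hf]
    rw [integral_add (integrable_const b) hi3, integral_sub hi1 hi2,
      integral_finsetSum _ fun i _ => (hiu i).const_mul _,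
      integral_finsetSum _ fun i _ => (hip i).const_mul _]
    simp only [integral_const_mul]
    simp
  have s1 : ∑ i, φ.x i * ∫ j, ∑ k, (req j).use i k * x j k ∂P ≤ ∑ i, φ.x i * (I.c i / I.m) :=
    Finset.sum_le_sum fun i _ => mul_le_mul_of_nonneg_left
      ((le_div_iff₀' hm).2 (hxu i)) (hφx i)
  have s2 : ∑ i, φ.y i * (Z / I.m) ≤ ∑ i, φ.y i * ∫ j, ∑ k, (req j).profit i k * x j k ∂P :=
    Finset.sum_le_sum fun i _ => mul_le_mul_of_nonneg_left
      ((div_le_iff₀' hm).2 (hxp i)) (hφy i)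
  have s3 : I.potential t Z φ
      = b + (∑ i, φ.x i * (I.c i / I.m) - ∑ i, φ.y i * (Z / I.m)) := by
    have e1 : ∀ i, φ.x i * (I.γ * I.c i * (1 + I.epsX t / (I.m * I.γ)) / I.epsX t)
        = φ.x i * (I.γ * I.c i / I.epsX t) + φ.x i * (I.c i / I.m) := by
      intro i; field_simp
    have e2 : ∀ i, φ.y i * (I.wmax * (1 - I.epsY t Z * Z / (I.m * I.wmax)) / I.epsY t Z)
        = φ.y i * (I.wmax / I.epsY t Z) - φ.y i * (Z / I.m) := by
      intro i; field_simp
    unfold potential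
    simp only [e1, e2, Finset.sum_add_distrib, Finset.sum_sub_distrib, hbdef]
    ring
  rw [hint, s3]
  linarith

/-- The failure probability of a stage. -/
theorem StageParams.iidProb_stageFailure_le (h : I.StageParams t Z)
    {sel : (Option K → ℝ) → Option K} (hsel : ∀ (f : Option K → ℝ) (o : Option K), f (sel f) ≤ f o)
    {req : J → Request n K} (hb : Bounded req (fun i => I.γ * I.c i) I.wmax)
    (P : Measure J) [IsProbabilityMeasure P] {x : J → K → ℝ} (hx : IsFractionalAssignment x)
    (hxu : ∀ i, I.m * ∫ j, ∑ k, (req j).use i k * x j k ∂P ≤ I.c i)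
    (hxp : ∀ i, Z ≤ I.m * ∫ j, ∑ k, (req j).profit i k * x j k ∂P) :
    iidProb P t {q | q.map req ∈ I.stageFailure sel t Z} ≤ ENNReal.ofReal
      (n * Real.exp (-(I.epsX t ^ 2 / (2 + I.epsX t) * (t * (1 / (I.m * I.γ))))) +
      n * Real.exp (-(I.epsY t Z ^ 2 / 2 * (t * (Z / (I.m * I.wmax)))))) := by
  set V : List J → ℝ≥0∞ := fun q =>
    ENNReal.ofReal (I.potential t Z (I.stageWeights sel t Z (q.map req))) with hV
  have hsup : ∀ q, ∫⁻ j, V (q ++ [j]) ∂P ≤ V q := by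
    intro q
    simp only [hV, List.map_append, List.map_cons, List.map_nil, stageWeights_append]
    exact h.lintegral_potential_update_le hsel hb P hx hxu hxp
      (fun i => (h.stageWeights_nonneg sel _ i).1) (fun i => (h.stageWeights_nonneg sel _ i).2)
  refine (iidProb_le_iidExp P (f := V) fun q hq hqS => ?_).trans
    ((iidExp_le_of_supermartingale P V hsup t).trans ?_)
  · rw [hV, ENNReal.one_le_ofReal]
    exact h.one_le_potential sel (by simpa using hq) hqS
  · exact ENNReal.ofReal_le_ofReal h.potential_initWeights_le

end Input

/-! ### Chernoff bounds for variables with values in [0, B] -/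

section ScaledTails

theorem sum_map_div {J : Type*} (q : List J) (Y : J → ℝ) (B : ℝ) :
    (q.map fun j => Y j / B).sum = (q.map Y).sum / B := by
  simp only [div_eq_mul_inv, List.sum_map_mul_right]

variable {J : Type*} [MeasurableSpace J] [DiscreteMeasurableSpace J] [Countable J]

theorem iidProb_upper_tail_scaled (P : Measure J) [IsProbabilityMeasure P] {Y : J → ℝ} {B : ℝ}
    (hB : 0 < B) (h0 : ∀ j, 0 ≤ Y j) (h1 : ∀ j, Y j ≤ B) {ε ν' ν : ℝ} (hε : 0 < ε)
    (hY : ∫ j, Y j ∂P ≤ ν') (hν : ν' ≤ ν) (t : ℕ) :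
    iidProb P t {q | t * ν' + ε * (t * ν) ≤ (q.map Y).sum}
      ≤ ENNReal.ofReal (Real.exp (-(ε ^ 2 / (2 + ε) * (t * (ν / B))))) := by
  refine (iidProb_mono P fun q _ hq => ?_).trans (iidProb_upper_tail P (X := fun j => Y j / B)
    (fun j => div_nonneg (h0 j) hB.le) (fun j => (div_le_one hB).2 (h1 j)) hε (μ' := ν' / B)
    (by rw [integral_div]; gcongr) (by gcongr) t)
  rw [Set.mem_ofPred_eq, sum_map_div, le_div_iff₀ hB]
  refine le_trans (le_of_eq ?_) hq
  field_simp

theorem iidProb_lower_tail_scaled (P : Measure J) [IsProbabilityMeasure P] {Y : J → ℝ} {B : ℝ}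
    (hB : 0 < B) (h0 : ∀ j, 0 ≤ Y j) (h1 : ∀ j, Y j ≤ B) {ε ν : ℝ} (hε : 0 < ε) (hε1 : ε < 1)
    (hν : 0 ≤ ν) (hY : ν ≤ ∫ j, Y j ∂P) (t : ℕ) :
    iidProb P t {q | (q.map Y).sum ≤ (1 - ε) * (t * ν)}
      ≤ ENNReal.ofReal (Real.exp (-(ε ^ 2 / 2 * (t * (ν / B))))) := by
  refine (iidProb_mono P fun q _ hq => ?_).trans (iidProb_lower_tail P (X := fun j => Y j / B)
    (fun j => div_nonneg (h0 j) hB.le) (fun j => (div_le_one hB).2 (h1 j)) hε hε1 (μ := ν / B)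
    (by positivity) (by rw [integral_div]; gcongr) t)
  rw [Set.mem_ofPred_eq, sum_map_div, div_le_iff₀ hB]
  refine le_trans hq (le_of_eq ?_)
  field_simp

end ScaledTails

/-! ### The linear program of a sample -/

section Sample

variable {n : ℕ} {J K : Type*} {req : J → Request n K}

/-- The `j`-th sample. -/
def sampleAt (req : J → Request n K) (q : List J) (j : Fin (q.map req).length) : J :=
  q.get (j.cast (by simp))

theorem get_map_req (q : List J) (j : Fin (q.map req).length) :
    (q.map req).get j = req (sampleAt req q j) := by
  simp [sampleAt]

theorem sum_sampleAt (q : List J) (f : J → ℝ) :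
    ∑ j, f (sampleAt req q j) = (q.map f).sum := by
  rw [← Fin.sum_univ_fun_getElem]
  exact Fintype.sum_equiv (finCongr (by simp)) _ _ fun j => by simp [sampleAt]

variable [Fintype K]

theorem bddAbove_sampleOpt (hn : 1 ≤ n) {A : Fin n → ℝ} {w : ℝ} (hb : Bounded req A w)
    (b : Fin n → ℝ) (q : List J) :
    BddAbove {v : ℝ | ∃ x : Fin (q.map req).length → K → ℝ, IsFractionalAssignment x ∧
      (∀ i, ∑ j, ∑ k, ((q.map req).get j).use i k * x j k ≤ b i) ∧
      ∀ i, v ≤ ∑ j, ∑ k, ((q.map req).get j).profit i k * x j k} := by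
  refine ⟨∑ _j : Fin (q.map req).length, w, ?_⟩
  rintro v ⟨x, hx, -, hv⟩
  refine (hv ⟨0, hn⟩).trans (Finset.sum_le_sum fun j _ =>
    hx.sum_mul_le (F := fun j k => ((q.map req).get j).profit ⟨0, hn⟩ k) hb.w_nonneg
      (fun j k => ?_) j)
  rw [get_map_req]
  exact hb.profit_le _ _ k

/-- A solution that overuses capacities by a factor s becomes feasible after division by s. -/
theorem le_sampleOpt (hn : 1 ≤ n) {A : Fin n → ℝ} {w : ℝ} (hb : Bounded req A w)
    {b : Fin n → ℝ} {x : J → K → ℝ} (hx : IsFractionalAssignment x) {s : ℝ} (hs : 1 ≤ s)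
    {v : ℝ} {q : List J}
    (hu : ∀ i, (q.map fun j => ∑ k, (req j).use i k * x j k).sum ≤ s * b i)
    (hp : ∀ i, s * v ≤ (q.map fun j => ∑ k, (req j).profit i k * x j k).sum) :
    v ≤ sampleOpt b (q.map req) := by
  have hs0 : 0 < s := by linarith
  refine le_csSup (bddAbove_sampleOpt hn hb b q)
    ⟨fun j k => x (sampleAt req q j) k / s, ⟨fun j k => div_nonneg (hx.1 _ k) hs0.le,
      fun j => ?_⟩, fun i => ?_, fun i => ?_⟩
  · rw [← Finset.sum_div, div_le_one hs0]
    exact (hx.2 _).trans hs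
  · simp only [get_map_req, ← mul_div_assoc, ← Finset.sum_div]
    rw [sum_sampleAt q fun j => ∑ k, (req j).use i k * x j k, div_le_iff₀' hs0]
    exact hu i
  · simp only [get_map_req, ← mul_div_assoc, ← Finset.sum_div]
    rw [sum_sampleAt q fun j => ∑ k, (req j).profit i k * x j k, le_div_iff₀' hs0]
    exact hp i

/-- Weak duality on a sample. -/
theorem sampleOpt_le {α β : Fin n → ℝ} {ρ : J → ℝ} (hα : ∀ i, 0 ≤ α i) (hβ : ∀ i, 0 ≤ β i)
    (hβ1 : ∑ i, β i = 1) (hρ : ∀ j, 0 ≤ ρ j)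
    (hd : ∀ j k, ∑ i, β i * (req j).profit i k - ∑ i, α i * (req j).use i k ≤ ρ j)
    {b : Fin n → ℝ} (hb : ∀ i, 0 ≤ b i) (q : List J) :
    sampleOpt b (q.map req) ≤ ∑ i, α i * b i + (q.map ρ).sum := by
  refine csSup_le ⟨0, 0, IsFractionalAssignment.zero, fun i => by simpa using hb i,
    fun i => by simp⟩ ?_
  rintro v ⟨x, hx, hu, hp⟩
  simp only [get_map_req] at hu hp
  have h1 : v ≤ ∑ i, β i * ∑ j, ∑ k, (req (sampleAt req q j)).profit i k * x j k := by
    calc v = ∑ i, β i * v := by rw [← Finset.sum_mul, hβ1, one_mul]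
      _ ≤ _ := Finset.sum_le_sum fun i _ => mul_le_mul_of_nonneg_left (hp i) (hβ i)
  have h2 : ∑ i, α i * ∑ j, ∑ k, (req (sampleAt req q j)).use i k * x j k ≤ ∑ i, α i * b i :=
    Finset.sum_le_sum fun i _ => mul_le_mul_of_nonneg_left (hu i) (hα i)
  have hswap : ∀ (a : Fin n → ℝ) (F : Fin (q.map req).length → Fin n → K → ℝ),
      ∑ i, a i * ∑ j, ∑ k, F j i k * x j k = ∑ j, ∑ k, (∑ i, a i * F j i k) * x j k := by
    intro a F
    simp only [Finset.mul_sum, Finset.sum_mul]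
    rw [Finset.sum_comm]
    refine Finset.sum_congr rfl fun j _ => ?_
    rw [Finset.sum_comm]
    exact Finset.sum_congr rfl fun k _ => Finset.sum_congr rfl fun i _ => by ring
  rw [hswap β fun j i k => (req (sampleAt req q j)).profit i k] at h1
  rw [hswap α fun j i k => (req (sampleAt req q j)).use i k] at h2
  have h3 : ∑ j, ∑ k, (∑ i, β i * (req (sampleAt req q j)).profit i k) * x j k
      - ∑ j, ∑ k, (∑ i, α i * (req (sampleAt req q j)).use i k) * x j k ≤ (q.map ρ).sum := by
    rw [← sum_sampleAt (req := req) q ρ, ← Finset.sum_sub_distrib]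
    refine Finset.sum_le_sum fun j _ => ?_
    rw [← Finset.sum_sub_distrib]
    simp only [← sub_mul]
    calc _ ≤ ∑ k, ρ (sampleAt req q j) * x j k :=
          Finset.sum_le_sum fun k _ => mul_le_mul_of_nonneg_right (hd _ k) (hx.1 j k)
      _ = ρ (sampleAt req q j) * ∑ k, x j k := by rw [Finset.mul_sum]
      _ ≤ ρ (sampleAt req q j) * 1 := mul_le_mul_of_nonneg_left (hx.2 j) (hρ _)
      _ = _ := mul_one _
  linarith

end Sample

/-! ### Accuracy of the estimate of the optimum -/

section Estimate

variable {n : ℕ} {J K : Type*} [Fintype K] [Countable J] [MeasurableSpace J]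
  [DiscreteMeasurableSpace J]

/-- The samples of length `t` on which the scaled fractional optimum is a bad estimate of `W`. -/
def estimateFailure (req : J → Request n K) (c : Fin n → ℝ) (m t : ℕ) (ε W : ℝ) : Set (List J) :=
  {q | ¬ ((1 - 3 * ε) * W ≤
        sampleOpt (fun i => t * c i / m) (q.map req) / (1 + ε) * ((m : ℝ) / t) ∧
      sampleOpt (fun i => t * c i / m) (q.map req) / (1 + ε) * ((m : ℝ) / t) ≤ W)}

/-- The 2n + 1 bad events are: the optimal x overuses a resource on the sample (n), it misses a
profit (n), or the dual gains are too large (1). Outside them the primal solution bounds the sample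
optimum from below and the dual solution from above. -/
theorem iidProb_estimateFailure_le (hn : 1 ≤ n) {c : Fin n → ℝ} (hc : ∀ i, 0 < c i)
    {req : J → Request n K} {γ w : ℝ} (hb : Bounded req (fun i => γ * c i) w) (p : PMF J) {m t : ℕ}
    (hm : 0 < (m : ℝ)) (ht : 0 < (t : ℝ)) (hγ : 0 < γ) (hW : 0 < expectedOpt m c req p)
    (hw : w ≤ γ * expectedOpt m c req p) {ε : ℝ} (hε : 0 < ε) (hε1 : ε < 1) :
    iidProb p.toMeasure t (estimateFailure req c m t ε (expectedOpt m c req p))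
      ≤ ENNReal.ofReal ((n + 1) * Real.exp (-(ε ^ 2 / (2 + ε) * (t * (1 / (m * γ)))))
        + n * Real.exp (-(ε ^ 2 / 2 * (t * (1 / (m * γ)))))) := by
  obtain ⟨⟨x, hx, hxu, hxp⟩, -⟩ := exists_optimal_assignment hn hc hb p m
  obtain ⟨α, β, ρ, hα, hβ, hβ1, hρ, hρw, hd, hdual⟩ := exists_dual_solution hn hc hb p m
  set W := expectedOpt m c req p with hWdef
  set P := p.toMeasure
  have hγW : 0 < γ * W := mul_pos hγ hW
  have hαc : 0 ≤ ∑ i, α i * c i := Finset.sum_nonneg fun i _ => mul_nonneg (hα i) (hc i).le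
  set U : Fin n → J → ℝ := fun i j => ∑ k, (req j).use i k * x j k with hU
  set V : Fin n → J → ℝ := fun i j => ∑ k, (req j).profit i k * x j k with hV
  set S₁ : Fin n → Set (List J) := fun i =>
    {q | t * (c i / m) + ε * (t * (c i / m)) ≤ (q.map (U i)).sum} with hS₁
  set S₂ : Fin n → Set (List J) := fun i =>
    {q | (q.map (V i)).sum ≤ (1 - ε) * (t * (W / m))} with hS₂
  set S₃ : Set (List J) :=
    {q | t * ((W - ∑ i, α i * c i) / m) + ε * (t * (W / m)) ≤ (q.map ρ).sum} with hS₃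
  set e₁ := Real.exp (-(ε ^ 2 / (2 + ε) * (t * (1 / (m * γ))))) with he₁
  set e₂ := Real.exp (-(ε ^ 2 / 2 * (t * (1 / (m * γ))))) with he₂
  have p₁ : ∀ i, iidProb P t (S₁ i) ≤ ENNReal.ofReal e₁ := by
    intro i
    have hci := hc i
    have := iidProb_upper_tail_scaled P (Y := U i) (B := γ * c i) (by positivity)
      (fun j => hx.sum_mul_nonneg (fun j => hb.use_nonneg j i) j)
      (fun j => hx.sum_mul_le (hb.A_nonneg i) (fun j => hb.use_le j i) j) hε
      ((le_div_iff₀' hm).2 (hxu i)) le_rfl t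
    rwa [show c i / m / (γ * c i) = 1 / (m * γ) by field_simp] at this
  have hWB : W / m / (γ * W) = 1 / (m * γ) := by field_simp
  have p₂ : ∀ i, iidProb P t (S₂ i) ≤ ENNReal.ofReal e₂ := by
    intro i
    have := iidProb_lower_tail_scaled P (Y := V i) (B := γ * W) hγW
      (fun j => hx.sum_mul_nonneg (fun j => hb.profit_nonneg j i) j)
      (fun j => (hx.sum_mul_le hb.w_nonneg (fun j => hb.profit_le j i) j).trans hw) hε hε1
      (by positivity) ((div_le_iff₀' hm).2 (hxp i)) t
    rwa [hWB] at this
  have p₃ : iidProb P t S₃ ≤ ENNReal.ofReal e₁ := by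
    have := iidProb_upper_tail_scaled P (Y := ρ) (B := γ * W) hγW hρ (fun j => (hρw j).trans hw) hε
      ((le_div_iff₀' hm).2 hdual) (ν := W / m) (by gcongr; linarith) t
    rwa [hWB] at this
  have hsub : ∀ q, q.length = t → q ∈ estimateFailure req c m t ε W →
      q ∈ ((⋃ i ∈ Finset.univ, S₁ i) ∪ ⋃ i ∈ Finset.univ, S₂ i) ∪ S₃ := by
    intro q _ hq
    by_contra hcon
    simp only [Finset.mem_univ, Set.iUnion_true, Set.mem_union, Set.mem_iUnion, not_or,
      not_exists, hS₁, hS₂, hS₃, Set.mem_ofPred_eq, not_le] at hcon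
    obtain ⟨⟨g₁, g₂⟩, g₃⟩ := hcon
    refine hq ⟨?_, ?_⟩
    · have hv : (1 - ε) * (t * W / m) / (1 + ε) ≤
          sampleOpt (fun i => t * c i / m) (q.map req) := by
        refine le_sampleOpt hn hb hx (s := 1 + ε) (by linarith) (fun i => ?_) fun i => ?_
        · refine (g₁ i).le.trans (le_of_eq ?_)
          ring
        · refine le_trans (le_of_eq ?_) (g₂ i).le
          field_simp
      -- One factor 1 + ε comes from making x feasible, the other from the definition of the
      -- estimate.
      calc (1 - 3 * ε) * W ≤ (1 - ε) / (1 + ε) ^ 2 * W := by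
            refine mul_le_mul_of_nonneg_right ?_ hW.le
            rw [le_div_iff₀ (by positivity)]
            nlinarith [pow_pos hε 3, pow_pos hε 2]
        _ = (1 - ε) * (t * W / m) / (1 + ε) / (1 + ε) * ((m : ℝ) / t) := by
            field_simp
        _ ≤ _ := by gcongr
    · have hv := sampleOpt_le hα hβ hβ1 hρ hd (b := fun i => t * c i / m)
        (fun i => by have := hc i; positivity) q
      have e : ∑ i, α i * (t * c i / m) = t / m * ∑ i, α i * c i := by
        rw [Finset.mul_sum]
        exact Finset.sum_congr rfl fun i _ => by ring
      -- The price term (t/m) ∑ α c is deterministic and cancels against the mean bound t (W - ∑ α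
      -- c)/m of the gains, leaving (t/m) W plus the deviation ε (t/m) W.
      have hv2 : sampleOpt (fun i => t * c i / m) (q.map req) ≤ (1 + ε) * (t * W / m) := by
        refine hv.trans ?_
        rw [e]
        refine (add_le_add_right g₃.le _).trans (le_of_eq ?_)
        field_simp
        ring
      calc _ ≤ (1 + ε) * (t * W / m) / (1 + ε) * ((m : ℝ) / t) := by gcongr
        _ = W := by field_simp
  refine (iidProb_mono P hsub).trans ((iidProb_union_le P t _ _).trans
    ((add_le_add_left (iidProb_union_le P t _ _) _).trans ?_))
  have q₁ := (iidProb_iUnion_le P t Finset.univ S₁).trans (Finset.sum_le_sum fun i _ => p₁ i)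
  have q₂ := (iidProb_iUnion_le P t Finset.univ S₂).trans (Finset.sum_le_sum fun i _ => p₂ i)
  refine (add_le_add (add_le_add q₁ q₂) p₃).trans (le_of_eq ?_)
  have h₁ : 0 ≤ e₁ := (Real.exp_pos _).le
  have h₂ : 0 ≤ e₂ := (Real.exp_pos _).le
  simp only [Finset.sum_const, Finset.card_univ, Fintype.card_fin, nsmul_eq_mul]
  rw [← ENNReal.ofReal_natCast n, ← ENNReal.ofReal_mul (by positivity),
    ← ENNReal.ofReal_mul (by positivity), ← ENNReal.ofReal_add (by positivity) (by positivity),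
    ← ENNReal.ofReal_add (by positivity) h₁]
  congr 1
  ring

end Estimate

/-! ### Choice of parameters and summation over the stages -/

theorem sum_sqrt_two_pow_le (l : ℕ) : ∑ r ∈ Finset.range l, √((2 : ℝ) ^ r) ≤ 3 * √(2 ^ l) := by
  induction l with
  | zero => simp
  | succ l ih =>
    rw [Finset.sum_range_succ, pow_succ, Real.sqrt_mul (by positivity)]
    -- The induction step needs 3 + 1 ≤ 3√2.
    have h : (4 / 3 : ℝ) ≤ √2 := Real.le_sqrt_of_sq_le (by norm_num)
    nlinarith [Real.sqrt_nonneg ((2 : ℝ) ^ l)]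

namespace Input

variable {n : ℕ} {I : Input n} {l : ℕ}

/-- The conditions on the input under which the algorithm is analysed. -/
structure Admissible (I : Input n) (l : ℕ) : Prop where
  n_pos : 1 ≤ n
  m_pos : 0 < (I.m : ℝ)
  γ_pos : 0 < I.γ
  ε_mul : I.ε * 2 ^ l = 1
  ε_le : I.ε ≤ 1 / 2
  firstLen_eq : (I.firstLen : ℝ) = I.ε * I.m
  γ_le : I.γ ≤ 1 / 10000 * I.ε ^ 2 / Real.log (n / I.ε)

namespace Admissible

theorem ε_pos (h : I.Admissible l) : 0 < I.ε := by
  have := h.ε_mul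
  by_contra! h0
  have : I.ε * 2 ^ l ≤ 0 := mul_nonpos_of_nonpos_of_nonneg h0 (by positivity)
  linarith

theorem l_pos (h : I.Admissible l) : 0 < l := by
  rcases Nat.eq_zero_or_pos l with rfl | hl
  · have h1 := h.ε_mul
    have h2 := h.ε_le
    norm_num at h1
    linarith
  · exact hl

theorem δ_eq (h : I.Admissible l) : I.δ = I.ε / (3 * l) := by
  have : 1 / I.ε = 2 ^ l := by
    rw [div_eq_iff h.ε_pos.ne', mul_comm, h.ε_mul]
  rw [δ, this, Real.logb_pow, Real.logb_self_eq_one (by norm_num), mul_one]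

theorem δ_pos (h : I.Admissible l) : 0 < I.δ := by
  have := h.l_pos
  have := h.ε_pos
  rw [h.δ_eq]
  positivity

theorem two_le_ratio (h : I.Admissible l) : 2 ≤ n / I.ε := by
  have hn : (1 : ℝ) ≤ n := by exact_mod_cast h.n_pos
  rw [le_div_iff₀ h.ε_pos]
  linarith [h.ε_le]

theorem log_pos (h : I.Admissible l) : 0 < Real.log (2 * n / I.δ) := by
  have hn : (1 : ℝ) ≤ n := by exact_mod_cast h.n_pos
  have hl : (1 : ℝ) ≤ l := by exact_mod_cast h.l_pos
  refine Real.log_pos ?_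
  rw [lt_div_iff₀ h.δ_pos, h.δ_eq, one_mul, div_lt_iff₀ (by positivity)]
  nlinarith [h.ε_le]

/-- With y = n/ε one has 2n/δ = 6yl, and l ≤ 2^l = 1/ε ≤ y and 6 ≤ 2^3 ≤ y^3 give 6yl ≤ y^5. -/
theorem log_le (h : I.Admissible l) :
    Real.log (2 * n / I.δ) ≤ 5 * Real.log (n / I.ε) := by
  have hε := h.ε_pos
  have hn : (1 : ℝ) ≤ n := by exact_mod_cast h.n_pos
  have hl : (l : ℝ) ≤ 1 / I.ε := by
    rw [le_div_iff₀ hε, ← h.ε_mul, mul_comm]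
    have : (l : ℝ) ≤ 2 ^ l := by exact_mod_cast Nat.lt_two_pow_self.le
    gcongr
  have h2 := h.two_le_ratio
  have hδ := h.δ_pos
  have h5 : 5 * Real.log (n / I.ε) = Real.log ((n / I.ε) ^ 5) := by
    rw [Real.log_pow]; norm_num
  rw [h5]
  refine Real.log_le_log (by positivity) ?_
  have e : 2 * n / I.δ = 6 * (n / I.ε) * l := by
    have := h.l_pos
    rw [h.δ_eq]
    field_simp
    ring
  have hl2 : (l : ℝ) ≤ n / I.ε := hl.trans (by gcongr)
  set y := (n : ℝ) / I.ε
  rw [e]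
  have h8 : (6 : ℝ) ≤ y ^ 3 := by
    have := pow_le_pow_left₀ (by norm_num : (0 : ℝ) ≤ 2) h2 3
    linarith
  calc 6 * y * l ≤ y ^ 3 * y * y := by gcongr
    _ = y ^ 5 := by ring

/-- Here c₀ = 1/10000 enters: 4 · 5 / 10000 ≤ 1/400. -/
theorem four_mul_le (h : I.Admissible l) :
    4 * I.γ * Real.log (2 * n / I.δ) ≤ (I.ε / 20) ^ 2 := by
  have hlog : 0 < Real.log (n / I.ε) := Real.log_pos (by linarith [h.two_le_ratio])
  have h1 := (le_div_iff₀ hlog).1 h.γ_le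
  have h2 := mul_le_mul_of_nonneg_left h.log_le h.γ_pos.le
  nlinarith [sq_nonneg I.ε]

theorem exp_neg_log (h : I.Admissible l) :
    Real.exp (-Real.log (2 * n / I.δ)) = I.δ / (2 * n) := by
  have hn : (1 : ℝ) ≤ n := by exact_mod_cast h.n_pos
  have := h.δ_pos
  rw [← Real.log_inv, Real.exp_log (by positivity), inv_div]

theorem epsX_pos (h : I.Admissible l) {t : ℕ} (ht : 0 < (t : ℝ)) : 0 < I.epsX t := by
  have := h.m_pos
  have := h.γ_pos
  have := h.log_pos
  exact Real.sqrt_pos.2 (by positivity)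

theorem epsX_sq (h : I.Admissible l) (t : ℕ) :
    I.epsX t ^ 2 = 4 * I.γ * I.m * Real.log (2 * n / I.δ) / t := by
  have := h.m_pos
  have := h.γ_pos
  have := h.log_pos
  exact Real.sq_sqrt (by positivity)

theorem epsX_le (h : I.Admissible l) {t : ℕ} (ht : I.ε * I.m ≤ t) : I.epsX t ≤ 1 / 20 := by
  have hm := h.m_pos
  have hε := h.ε_pos
  have ht0 : 0 < (t : ℝ) := lt_of_lt_of_le (by positivity) ht
  refine abs_le_of_sq_le_sq' ?_ (by norm_num) |>.2
  rw [h.epsX_sq, div_le_iff₀ ht0]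
  have h4 := mul_le_mul_of_nonneg_right h.four_mul_le hm.le
  have h5 : I.ε * (I.ε * I.m) ≤ 1 * t := mul_le_mul (by linarith [h.ε_le]) ht (by positivity)
    (by norm_num)
  nlinarith

/-- With L = ln(2n/δ), the exponents are 4L/(2+ε_x) and 2L, and both are at least L because ε_x ≤ 2.
-/
theorem exp_epsX_le (h : I.Admissible l) {t : ℕ} (ht : I.ε * I.m ≤ t) :
    Real.exp (-(I.epsX t ^ 2 / (2 + I.epsX t) * (t * (1 / (I.m * I.γ))))) ≤ I.δ / (2 * n) ∧
      Real.exp (-(I.epsX t ^ 2 / 2 * (t * (1 / (I.m * I.γ))))) ≤ I.δ / (2 * n) := by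
  have hm := h.m_pos
  have hε := h.ε_pos
  have hγ := h.γ_pos
  have hL := h.log_pos
  have ht0 : 0 < (t : ℝ) := lt_of_lt_of_le (by positivity) ht
  have hX := h.epsX_pos ht0
  have hX2 := h.epsX_le ht
  rw [← h.exp_neg_log, Real.exp_le_exp, Real.exp_le_exp, neg_le_neg_iff, neg_le_neg_iff]
  have e : ∀ s : ℝ, I.epsX t ^ 2 / s * (t * (1 / (I.m * I.γ)))
      = 4 * Real.log (2 * n / I.δ) / s := by
    intro s
    rw [h.epsX_sq]
    field_simp
  rw [e, e]
  constructor
  · rw [le_div_iff₀ (by linarith)]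
    nlinarith
  · linarith

theorem len_eq (h : I.Admissible l) (r : ℕ) : (I.len r : ℝ) = I.m * (I.ε * 2 ^ r) := by
  rw [len, Nat.cast_mul, h.firstLen_eq]
  push_cast
  ring

theorem m_eq (h : I.Admissible l) : I.m = I.len l := by
  have := h.len_eq l
  rw [h.ε_mul, mul_one] at this
  exact_mod_cast this.symm

theorem le_len (h : I.Admissible l) (r : ℕ) : I.ε * I.m ≤ I.len r := by
  rw [h.len_eq, mul_comm, mul_comm I.ε]
  have h1 : (1 : ℝ) ≤ 2 ^ r := one_le_pow₀ (by norm_num)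
  have := mul_pos h.m_pos h.ε_pos
  nlinarith

theorem le_prevLen (h : I.Admissible l) (r : ℕ) : I.ε * I.m ≤ I.prevLen r := by
  unfold prevLen
  split_ifs
  · exact h.firstLen_eq.ge
  · exact h.le_len _

theorem len_le_prevLen (I : Input n) (r : ℕ) : I.len r ≤ 2 * I.prevLen r := by
  unfold prevLen
  cases r with
  | zero => simp [len]; omega
  | succ r => simp [I.len_succ]; omega

theorem epsX_prevLen_le (h : I.Admissible l) (r : ℕ) :
    I.epsX (I.prevLen r) ≤ 2 * I.epsX (I.len r) := by
  have hm := h.m_pos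
  have hγ := h.γ_pos
  have hL := h.log_pos
  have hp := mul_pos h.ε_pos hm
  have ht0 : 0 < (I.len r : ℝ) := hp.trans_le (h.le_len r)
  have ht1 : 0 < (I.prevLen r : ℝ) := hp.trans_le (h.le_prevLen r)
  have hle : (I.len r : ℝ) ≤ 2 * I.prevLen r := by exact_mod_cast len_le_prevLen I r
  refine abs_le_of_sq_le_sq' ?_ (by have := h.epsX_pos ht0; positivity) |>.2
  rw [mul_pow, h.epsX_sq, h.epsX_sq, ← mul_div_assoc, div_le_div_iff₀ ht1 ht0]
  have hc : 0 < 4 * I.γ * I.m * Real.log (2 * n / I.δ) := by positivity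
  nlinarith

/-- The relative errors of the stages, weighted by the lengths of the stages. -/
theorem sum_epsX_le (h : I.Admissible l) :
    ∑ r ∈ Finset.range l, I.ε * 2 ^ r * I.epsX (I.len r) ≤ 3 * I.ε / 20 := by
  have hm := h.m_pos
  have hγ := h.γ_pos
  have hL := h.log_pos
  have hε := h.ε_pos
  -- The error is proportional to 1/√(ε 2^r), so weighting by ε 2^r leaves √(ε 2^r), a geometric
  -- sequence with ratio √2.
  have e : ∀ r, I.ε * 2 ^ r * I.epsX (I.len r)
      = √(4 * I.γ * Real.log (2 * n / I.δ)) * (√I.ε * √(2 ^ r)) := by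
    intro r
    have hx : I.epsX (I.len r) = √(4 * I.γ * Real.log (2 * n / I.δ)) / √(I.ε * 2 ^ r) := by
      rw [epsX, h.len_eq, ← Real.sqrt_div (by positivity)]
      congr 1
      field_simp
    rw [hx, ← Real.sqrt_mul hε.le]
    have hpos : 0 < I.ε * 2 ^ r := by positivity
    generalize I.ε * 2 ^ r = s at hpos
    rw [mul_div_assoc', mul_comm, mul_div_assoc, Real.div_sqrt]
  have hκ : √(4 * I.γ * Real.log (2 * n / I.δ)) ≤ I.ε / 20 :=
    (Real.sqrt_le_sqrt h.four_mul_le).trans_eq (Real.sqrt_sq (by positivity))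
  have hs : √I.ε * ∑ r ∈ Finset.range l, √((2 : ℝ) ^ r) ≤ 3 := by
    refine (mul_le_mul_of_nonneg_left (sum_sqrt_two_pow_le l) (Real.sqrt_nonneg _)).trans_eq ?_
    rw [mul_left_comm, ← Real.sqrt_mul hε.le, h.ε_mul, Real.sqrt_one, mul_one]
  simp only [e]
  rw [← Finset.mul_sum, ← Finset.mul_sum]
  refine (mul_le_mul hκ hs (by positivity) (by positivity)).trans_eq ?_
  ring

/-- The missing ε is the share of stage -1. -/
theorem sum_len (h : I.Admissible l) : ∑ r ∈ Finset.range l, I.ε * 2 ^ r = 1 - I.ε := by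
  rw [← Finset.mul_sum, geom_sum_eq (by norm_num)]
  have := h.ε_mul
  linarith

/-- A good estimate satisfies Z ≥ W/2, hence w_max ≤ 2γZ. The constants 2 and 4 in ε_y and ε_x then
give ε_y ≤ ε_x, so a single error sequence suffices. -/
theorem stageParams (h : I.Admissible l) (hc : ∀ i, 0 < I.c i) {W Z : ℝ} (hw : 0 < I.wmax)
    (hwW : I.wmax ≤ I.γ * W) (hW : 0 < W) (hWm : W ≤ I.m * I.wmax) (r : ℕ)
    (hZ : (1 - 3 * I.epsX (I.prevLen r)) * W ≤ Z) (hZW : Z ≤ W) :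
    I.StageParams (I.len r) Z ∧ I.epsY (I.len r) Z ≤ I.epsX (I.len r) := by
  have hm := h.m_pos
  have hγ := h.γ_pos
  have hL := h.log_pos
  have ht : 0 < (I.len r : ℝ) := (mul_pos h.ε_pos hm).trans_le (h.le_len r)
  have h1 := h.epsX_le (h.le_prevLen r)
  have hZ2 : W / 2 ≤ Z := by nlinarith
  have hZ0 : 0 < Z := by linarith
  have hYX : I.epsY (I.len r) Z ≤ I.epsX (I.len r) := by
    refine Real.sqrt_le_sqrt ?_
    rw [div_le_div_iff₀ (by positivity) ht]
    have h2 : I.wmax ≤ I.γ * (2 * Z) := hwW.trans (by gcongr; linarith)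
    calc 2 * I.wmax * I.m * Real.log (2 * n / I.δ) * I.len r
        ≤ 2 * (I.γ * (2 * Z)) * I.m * Real.log (2 * n / I.δ) * I.len r := by gcongr
      _ = _ := by ring
  refine ⟨⟨hc, hm, hγ, hw, hZ0, hZW.trans hWm, by exact_mod_cast ht, h.epsX_pos ht,
    Real.sqrt_pos.2 (by positivity), ?_⟩, hYX⟩
  linarith [h.epsX_le (h.le_len r)]

variable {J K : Type*} [Fintype K]

/-- If all estimates are good and no stage fails, then the algorithm is near-optimal. -/
theorem achieves (h : I.Admissible l) (hc : ∀ i, 0 < I.c i) {W : ℝ} (hw : 0 < I.wmax)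
    (hwW : I.wmax ≤ I.γ * W) (hW : 0 < W) (hWm : W ≤ I.m * I.wmax)
    {sel : (Option K → ℝ) → Option K} {R : Fin I.m → Request n K} {Z : ℕ → ℝ}
    (hZr : ∀ r, Z r = I.estimate r ((List.ofFn R).take (I.len r)))
    (hZ : ∀ r < l, (1 - 3 * I.epsX (I.prevLen r)) * W ≤ Z r ∧ Z r ≤ W)
    (hs : ∀ r < l, ((List.ofFn R).drop (I.len r)).take (I.len r) ∉
      I.stageFailure sel (I.len r) (Z r)) :
    I.Achieves sel R (W * (1 - 3 * I.ε)) := by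
  have hm := h.m_pos
  have hε := h.ε_pos
  have hlen : (List.ofFn R).length = I.len l := by rw [List.length_ofFn, ← h.m_eq]
  have htot : ∀ g : Request n K → Option K → ℝ, (∀ a, g a none = 0) →
      ∑ t, g (R t) (I.served sel R t) = ∑ r ∈ Finset.range l,
        run (I.stagePolicy sel (I.len r) (Z r)) g []
          (((List.ofFn R).drop (I.len r)).take (I.len r)) := by
    intro g hg
    have h1 := sum_eq_run (I.decision sel) g [] R
    simp only [List.nil_append] at h1
    simp only [served, h1, hZr]
    exact I.run_decision sel hg hlen
  have hs' : ∀ r < l, _ := fun r hr => not_not.1 (hs r hr)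
  constructor
  · intro i
    rw [htot (fun a => a.useOf i) fun a => rfl]
    have hci := hc i
    calc _ ≤ ∑ r ∈ Finset.range l, I.c i * (I.ε * 2 ^ r + I.ε * 2 ^ r * I.epsX (I.len r)) :=
          Finset.sum_le_sum fun r hr => ((hs' r (Finset.mem_range.1 hr)).1 i).trans_eq (by
            rw [h.len_eq]; field_simp)
      _ ≤ I.c i * 1 := by
          -- The reserve of stage -1 pays for the overuse: 1 - ε + 3ε/20 ≤ 1.
          rw [← Finset.mul_sum, Finset.sum_add_distrib, h.sum_len]
          gcongr
          linarith [h.sum_epsX_le]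
      _ = I.c i := mul_one _
  · intro i
    rw [htot (fun a => a.profitOf i) fun a => rfl]
    -- The relative loss in stage r is 7 ε_x: the estimate costs 3 ε_{x,r-1} ≤ 6 ε_{x,r}, the
    -- service ε_y ≤ ε_x. With the share ε of stage -1 the total is ε + 7 · 3ε/20 ≤ 3ε.
    calc W * (1 - 3 * I.ε)
        ≤ W * ∑ r ∈ Finset.range l, (I.ε * 2 ^ r - 7 * (I.ε * 2 ^ r * I.epsX (I.len r))) := by
          rw [Finset.sum_sub_distrib, h.sum_len, ← Finset.mul_sum]
          exact mul_le_mul_of_nonneg_left (by linarith [h.sum_epsX_le]) hW.le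
      _ = ∑ r ∈ Finset.range l, W * (I.ε * 2 ^ r - 7 * (I.ε * 2 ^ r * I.epsX (I.len r))) :=
          Finset.mul_sum _ _ _
      _ ≤ _ := Finset.sum_le_sum fun r hr => by
          have hr' := Finset.mem_range.1 hr
          refine le_trans ?_ ((hs' r hr').2 i)
          obtain ⟨z1, z2⟩ := hZ r hr'
          obtain ⟨hp, hYX⟩ := h.stageParams hc hw hwW hW hWm r z1 z2
          have hpe := h.epsX_prevLen_le r
          have hX := hp.x_pos
          have hX2 := h.epsX_le (h.le_len r)
          have hZ3 : (1 - 6 * I.epsX (I.len r)) * W ≤ Z r :=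
            le_trans (mul_le_mul_of_nonneg_right (by linarith) hW.le) z1
          have e : (1 - I.epsY (I.len r) (Z r)) * (I.len r * Z r / I.m)
              = I.ε * 2 ^ r * ((1 - I.epsY (I.len r) (Z r)) * Z r) := by
            rw [h.len_eq]; field_simp
          rw [e]
          have h3 : W * (1 - 7 * I.epsX (I.len r)) ≤ (1 - I.epsY (I.len r) (Z r)) * Z r :=
            calc W * (1 - 7 * I.epsX (I.len r))
                ≤ (1 - I.epsX (I.len r)) * ((1 - 6 * I.epsX (I.len r)) * W) := by
                  nlinarith [mul_pos hW (pow_pos hX 2)]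
              _ ≤ (1 - I.epsX (I.len r)) * Z r :=
                  mul_le_mul_of_nonneg_left hZ3 (by linarith)
              _ ≤ _ := mul_le_mul_of_nonneg_right (by linarith) hp.Z_pos.le
          calc _ = I.ε * 2 ^ r * (W * (1 - 7 * I.epsX (I.len r))) := by ring
            _ ≤ _ := mul_le_mul_of_nonneg_left h3 (by positivity)

/-! ### Failure probabilities and the union bound -/

variable [Countable J] [MeasurableSpace J] [DiscreteMeasurableSpace J]

theorem iidProb_estimateFailure_le (h : I.Admissible l) (hc : ∀ i, 0 < I.c i)
    {req : J → Request n K} (hb : Bounded req (fun i => I.γ * I.c i) I.wmax) (p : PMF J)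
    (hW : 0 < expectedOpt I.m I.c req p) (hwW : I.wmax ≤ I.γ * expectedOpt I.m I.c req p) (r : ℕ) :
    iidProb p.toMeasure (I.prevLen r) (estimateFailure req I.c I.m (I.prevLen r)
      (I.epsX (I.prevLen r)) (expectedOpt I.m I.c req p)) ≤ ENNReal.ofReal (2 * I.δ) := by
  have ht := h.le_prevLen r
  have ht0 : 0 < (I.prevLen r : ℝ) := (mul_pos h.ε_pos h.m_pos).trans_le ht
  have hn : (1 : ℝ) ≤ n := by exact_mod_cast h.n_pos
  have hδ := h.δ_pos
  obtain ⟨h1, h2⟩ := h.exp_epsX_le ht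
  refine (OnlineRA.iidProb_estimateFailure_le h.n_pos hc hb p h.m_pos ht0 h.γ_pos hW hwW
    (h.epsX_pos ht0) (by linarith [h.epsX_le ht])).trans (ENNReal.ofReal_le_ofReal ?_)
  calc _ ≤ (n + 1) * (I.δ / (2 * n)) + n * (I.δ / (2 * n)) := by gcongr
    _ = I.δ + I.δ / (2 * n) := by field_simp; ring
    _ ≤ I.δ + I.δ := by
      gcongr
      exact div_le_self hδ.le (by linarith)
    _ = _ := by ring

theorem iidProb_stageFailure_le (h : I.Admissible l) (hc : ∀ i, 0 < I.c i)
    {sel : (Option K → ℝ) → Option K} (hsel : ∀ (f : Option K → ℝ) (o : Option K), f (sel f) ≤ f o)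
    {req : J → Request n K} (hb : Bounded req (fun i => I.γ * I.c i) I.wmax) (p : PMF J)
    {x : J → K → ℝ} (hx : IsFractionalAssignment x)
    (hxu : ∀ i, I.m * ∫ j, ∑ k, (req j).use i k * x j k ∂p.toMeasure ≤ I.c i) {W Z : ℝ}
    (hxp : ∀ i, W ≤ I.m * ∫ j, ∑ k, (req j).profit i k * x j k ∂p.toMeasure)
    (hw : 0 < I.wmax) (hwW : I.wmax ≤ I.γ * W) (hW : 0 < W) (hWm : W ≤ I.m * I.wmax) (r : ℕ)
    (hZ : (1 - 3 * I.epsX (I.prevLen r)) * W ≤ Z) (hZW : Z ≤ W) :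
    iidProb p.toMeasure (I.len r) {q | q.map req ∈ I.stageFailure sel (I.len r) Z}
      ≤ ENNReal.ofReal I.δ := by
  obtain ⟨hp, -⟩ := h.stageParams hc hw hwW hW hWm r hZ hZW
  have hn : (1 : ℝ) ≤ n := by exact_mod_cast h.n_pos
  have hm := h.m_pos
  have hL := h.log_pos
  have hZ0 := hp.Z_pos
  have ht : 0 < (I.len r : ℝ) := by exact_mod_cast hp.t_pos
  have h1 := (h.exp_epsX_le (h.le_len r)).1
  have h2 : Real.exp (-(I.epsY (I.len r) Z ^ 2 / 2 * (I.len r * (Z / (I.m * I.wmax)))))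
      = I.δ / (2 * n) := by
    rw [← h.exp_neg_log, epsY, Real.sq_sqrt (by positivity)]
    congr 2
    field_simp
  refine (hp.iidProb_stageFailure_le hsel hb p.toMeasure hx hxu
    (fun i => hZW.trans (hxp i))).trans (ENNReal.ofReal_le_ofReal ?_)
  rw [h2]
  calc _ ≤ n * (I.δ / (2 * n)) + n * (I.δ / (2 * n)) := by gcongr
    _ = I.δ := by field_simp; ring

theorem measure_achieves (h : I.Admissible l) (hc : ∀ i, 0 < I.c i)
    {sel : (Option K → ℝ) → Option K} (hsel : ∀ (f : Option K → ℝ) (o : Option K), f (sel f) ≤ f o)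
    {req : J → Request n K} (hb : Bounded req (fun i => I.γ * I.c i) I.wmax) (p : PMF J)
    (hw : 0 < I.wmax) (hW : 0 < expectedOpt I.m I.c req p)
    (hwW : I.wmax ≤ I.γ * expectedOpt I.m I.c req p)
    (hWm : expectedOpt I.m I.c req p ≤ I.m * I.wmax) :
    1 - I.ε ≤ (Measure.pi fun _ : Fin I.m => p.toMeasure).real
      {R | I.Achieves sel (fun t => req (R t)) (expectedOpt I.m I.c req p * (1 - 3 * I.ε))} := by
  obtain ⟨⟨x, hx, hxu, hxp⟩, -⟩ := exists_optimal_assignment h.n_pos hc hb p I.m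
  set W := expectedOpt I.m I.c req p with hWdef
  set P := p.toMeasure with hP
  set Z : ℕ → List J → ℝ := fun r q => I.estimate r ((q.map req).take (I.len r)) with hZdef
  set E₁ : ℕ → Set (List J) := fun r => {q | (q.drop (I.prevStart r)).take (I.prevLen r) ∈
    estimateFailure req I.c I.m (I.prevLen r) (I.epsX (I.prevLen r)) W} with hE₁
  -- Including the accuracy of Z in this event lets the stage bound be applied conditionally on the
  -- past: prefixes with a bad estimate contribute nothing here and are counted in E₁.
  set E₂ : ℕ → Set (List J) := fun r =>
    {q | ((1 - 3 * I.epsX (I.prevLen r)) * W ≤ Z r q ∧ Z r q ≤ W) ∧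
      ((q.drop (I.len r)).take (I.len r)).map req ∈ I.stageFailure sel (I.len r) (Z r q)} with hE₂
  have hlen : ∀ r < l, I.len r + I.len r ≤ I.m := by
    intro r hr
    rw [h.m_eq, ← I.len_succ]
    exact Nat.mul_le_mul_left _ (Nat.pow_le_pow_right (by norm_num) hr)
  have p₁ : ∀ r < l, iidProb P I.m (E₁ r) ≤ ENNReal.ofReal (2 * I.δ) := fun r hr =>
    (iidProb_drop_take_le P (by rw [prevStart_add_prevLen]; linarith [hlen r hr]) _).trans
      (h.iidProb_estimateFailure_le hc hb p hW hwW r)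
  have p₂ : ∀ r < l, iidProb P I.m (E₂ r) ≤ ENNReal.ofReal I.δ := by
    intro r hr
    obtain ⟨d, hd⟩ := Nat.exists_eq_add_of_le (hlen r hr)
    rw [hd, add_assoc]
    -- Given the t_r requests before the stage, Z is a constant and the requests of the stage are
    -- fresh samples.
    refine iidProb_append_le P fun q hq => ?_
    have hZq : ∀ q', Z r (q ++ q') = Z r q := by
      intro q'
      simp only [hZdef, List.map_append]
      rw [List.take_append_of_le_length (by simp [hq])]
    by_cases hg : (1 - 3 * I.epsX (I.prevLen r)) * W ≤ Z r q ∧ Z r q ≤ W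
    · refine le_trans ?_ (h.iidProb_stageFailure_le hc hsel hb p hx hxu hxp hw hwW hW hWm r
        hg.1 hg.2)
      rw [← iidProb_take P (I.len r) d]
      refine iidProb_mono P fun q' _ hq' => ?_
      have := hq'.2
      rwa [hZq, ← hq, List.drop_left, hq] at this
    · refine (iidProb_mono P (T := ∅) fun q' _ hq' => hg ?_).trans ?_
      · have := hq'.1
        rwa [hZq] at this
      · rw [iidProb, Set.indicator_empty]
        exact (iidExp_const P _ 0).le.trans zero_le
  have hbad : (Measure.pi fun _ : Fin I.m => P)
      {R | I.Achieves sel (fun t => req (R t)) (W * (1 - 3 * I.ε))}ᶜ ≤ ENNReal.ofReal I.ε := by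
    calc _ ≤ (Measure.pi fun _ : Fin I.m => P)
          {R | List.ofFn R ∈ ⋃ r ∈ Finset.range l, E₁ r ∪ E₂ r} := by
          refine measure_mono fun R hR => ?_
          by_contra hcon
          simp only [Set.mem_ofPred_eq, Set.mem_iUnion, Finset.mem_range, not_exists,
            Set.mem_union, not_or] at hcon
          have hmap : (List.ofFn R).map req = List.ofFn fun t => req (R t) := by
            rw [List.map_ofFn]; rfl
          have hZ : ∀ r < l, (1 - 3 * I.epsX (I.prevLen r)) * W ≤ Z r (List.ofFn R) ∧
              Z r (List.ofFn R) ≤ W := by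
            intro r hr
            have h1 := not_not.1 (hcon r hr).1
            have e : Z r (List.ofFn R) = sampleOpt (fun i => I.prevLen r * I.c i / I.m)
                ((((List.ofFn R).drop (I.prevStart r)).take (I.prevLen r)).map req)
                / (1 + I.epsX (I.prevLen r)) * ((I.m : ℝ) / I.prevLen r) := by
              simp only [hZdef, estimate]
              rw [← I.prevStart_add_prevLen r, List.drop_take, Nat.add_sub_cancel_left,
                List.take_take, min_self, List.map_take, List.map_drop]
            rw [e]
            exact h1
          refine hR (h.achieves hc hw hwW hW hWm (Z := fun r => Z r (List.ofFn R))
            (fun r => by simp only [hZdef, hmap]) hZ fun r hr hf => (hcon r hr).2 ⟨hZ r hr, ?_⟩)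
          rwa [List.map_take, List.map_drop, hmap]
      _ = iidProb P I.m (⋃ r ∈ Finset.range l, E₁ r ∪ E₂ r) := pi_ofFn_mem P I.m _
      _ ≤ ∑ r ∈ Finset.range l, iidProb P I.m (E₁ r ∪ E₂ r) := iidProb_iUnion_le P _ _ _
      -- Each stage contributes 2δ + δ, and 3lδ = ε by the choice of δ.
      _ ≤ ∑ _r ∈ Finset.range l, ENNReal.ofReal (3 * I.δ) := Finset.sum_le_sum fun r hr => by
          have hδ := h.δ_pos
          rw [Finset.mem_range] at hr
          refine (iidProb_union_le P _ _ _).trans ((add_le_add (p₁ r hr) (p₂ r hr)).trans_eq ?_)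
          rw [← ENNReal.ofReal_add (by positivity) hδ.le]
          congr 1
          ring
      _ = ENNReal.ofReal I.ε := by
          have hl := h.l_pos
          rw [Finset.sum_const, Finset.card_range, nsmul_eq_mul, ← ENNReal.ofReal_natCast l,
            ← ENNReal.ofReal_mul (by positivity), h.δ_eq]
          congr 1
          field_simp
  have hreal := ENNReal.toReal_le_of_le_ofReal h.ε_pos.le hbad
  have hcompl := probReal_compl_eq_one_sub (μ := Measure.pi fun _ : Fin I.m => P)
    (s := {R | I.Achieves sel (fun t => req (R t)) (W * (1 - 3 * I.ε))}) .of_discrete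
  rw [Measure.real] at hcompl
  linarith

end Admissible

end Input

end OnlineRA

theorem mainTheorem1 :
    ∃ c₀ C : ℝ, 0 < c₀ ∧ 0 < C ∧
      ∀ (n : ℕ) (K : Type*) [Fintype K] (J : Type*) [Countable J] [MeasurableSpace J]
        [DiscreteMeasurableSpace J] (req : J → OnlineRA.Request n K) (p : PMF J)
        (I : OnlineRA.Input n) (sel : (Option K → ℝ) → Option K),
        1 ≤ n →
        (∀ i, 0 < I.c i) →
        (∀ j i k, 0 ≤ (req j).use i k) →
        (∀ j i k, 0 ≤ (req j).profit i k) →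
        (∀ (f : Option K → ℝ) (o : Option K), f (sel f) ≤ f o) →
        0 < OnlineRA.expectedOpt I.m I.c req p →
        (∀ j i k, (req j).use i k ≤ I.γ * I.c i) →
        (∀ j i k, (req j).profit i k ≤ I.wmax) →
        I.wmax ≤ I.γ * OnlineRA.expectedOpt I.m I.c req p →
        1 / (I.m : ℝ) ≤ I.ε → I.ε ≤ 1 / 2 →
        (∃ l : ℕ, I.ε * 2 ^ l = 1) →
        (∃ u : ℕ, I.ε * I.m = u) →
        I.γ ≤ c₀ * I.ε ^ 2 / Real.log (n / I.ε) →
        1 - I.ε ≤ (MeasureTheory.Measure.pi fun _ : Fin I.m => p.toMeasure).real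
          {R | I.Achieves sel (fun t => req (R t))
            (OnlineRA.expectedOpt I.m I.c req p * (1 - C * I.ε))} := by
  refine ⟨1 / 10000, 3, by norm_num, by norm_num, ?_⟩
  intro n K _ J _ _ _ req p I sel hn hc hu hp hsel hW huse hprofit hwW _ hε2 ⟨l, hl⟩ ⟨u, hu'⟩ hγ
  have hwm : 0 < I.wmax ∧ 0 < (I.m : ℝ) ∧
      OnlineRA.expectedOpt I.m I.c req p ≤ I.m * I.wmax := by
    -- `Bounded` asks for nonnegative bounds, and the signs of γ and w_max are not yet known; hence
    -- the truncation at 0. From 0 < W ≤ m max(0, w_max) the positivity of m and w_max follows.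
    have hw0 : OnlineRA.Bounded req (fun i => max 0 (I.γ * I.c i)) (max 0 I.wmax) :=
      ⟨hu, hp, fun j i k => le_max_of_le_right (huse j i k),
        fun j i k => le_max_of_le_right (hprofit j i k), fun i => le_max_left _ _, le_max_left _ _⟩
    obtain ⟨⟨x, hx, -, hxp⟩, -⟩ := OnlineRA.exists_optimal_assignment hn hc hw0 p I.m
    have h1 : OnlineRA.expectedOpt I.m I.c req p ≤ I.m * max 0 I.wmax := by
      refine (hxp ⟨0, hn⟩).trans (mul_le_mul_of_nonneg_left ?_ I.m.cast_nonneg)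
      have := MeasureTheory.integral_mono
        (hx.integrable hw0.w_nonneg (fun j => hp j ⟨0, hn⟩) (fun j => hw0.profit_le j ⟨0, hn⟩)
          p.toMeasure) (MeasureTheory.integrable_const (max 0 I.wmax))
        (hx.sum_mul_le hw0.w_nonneg fun j => hw0.profit_le j ⟨0, hn⟩)
      simpa using this
    have h2 := hW.trans_le h1
    have hpos : 0 < max 0 I.wmax := by
      by_contra! h0
      exact absurd h2 (not_lt.2 (mul_nonpos_of_nonneg_of_nonpos I.m.cast_nonneg h0))
    have hw : 0 < I.wmax := by simpa using hpos
    rw [max_eq_right hw.le] at h1 h2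
    exact ⟨hw, (mul_pos_iff_of_pos_right hw).1 h2, h1⟩
  obtain ⟨hw, hm, hWm⟩ := hwm
  have hγ0 : 0 < I.γ := by
    by_contra! h0
    linarith [mul_nonpos_of_nonpos_of_nonneg h0 hW.le]
  have hadm : I.Admissible l := ⟨hn, hm, hγ0, hl, hε2, by
    rw [OnlineRA.Input.firstLen, hu', Nat.floor_natCast], hγ⟩
  exact hadm.measure_achieves hc hsel
    ⟨hu, hp, huse, hprofit, fun i => (mul_pos hγ0 (hc i)).le, hw.le⟩ p hw hW hwW hWm
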